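/- **Setting.** Let $p^*,q^*$ be probability densities on $\mathbb R^m$, $h:\mathbb R^m\to\mathbb R^d$ and $w:\mathbb R^m\to\mathbb R$ measurable, $\Theta\subset\mathbb R^d$ compact and convex. Put $r(x;\theta,C)=C\exp(\theta^Th(x))$ and $C^*_\theta=\mathbb E_{p^*}[w]/\mathbb E_{q^*}[e^{\theta^Th}w]$. Suppose that there is an interior point $\theta^*$ of $\Theta$, with $\{\theta:\|\theta-\theta^*\|_2<\rho\}\subseteq\Theta$, $\rho>0$, such that $p^*(x)=r(x;\theta^*,C^*_{\theta^*})q^*(x)$ for all $x$. Let $S=\{t:\theta^*_t\ne0\}$ and $k=|S|$. The reference dataset consists of $n_p^*$ inliers, i.i.d. from $p^*$, and $o_p$ outliers; the target dataset consists of $n_q^*$ inliers, i.i.d. from $q^*$, and $o_q$ outliers. The outliers are arbitrary (possibly random). Let $\varepsilon_p=o_p/(n_p^*+o_p)$, $\varepsilon_q=o_q/(n_q^*+o_q)$, $\varepsilon=\max\{\varepsilon_p,\varepsilon_q\}\le\bar\varepsilon<1$, $n^*_{p,q}=\min\{n_p^*,n_q^*\}$. With $\hat{\mathbb E}_{p^\dagger},\hat{\mathbb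 E}_{q^\dagger}$ the empirical means over the full (contaminated) datasets, let $$\mathcal L^\dagger(\theta)=-\hat{\mathbb E}_{p^\dagger}[\theta^Th\,w]+\hat{\mathbb E}_{p^\dagger}[w]\,\log\hat{\mathbb E}_{q^\dagger}[e^{\theta^Th}w],\qquad \hat\theta=\operatorname*{argmin}_\theta\ \mathcal L^\dagger(\theta)+\lambda\|\theta\|_1 .$$ Let $\nu$ be the maximum of the following quantities, taken over all coordinates $t,t'\in\{1,\dots,d\}$, $s,s'\in S$, all $\theta\in\Theta$, all reference outliers $x$ and all target outliers $y$ (a maximum over an empty set being $0$): $w(x)$, $w(x)|h_t(x)|$, $e^{\theta^Th(y)}w(y)$, $e^{\theta^Th(y)}w(y)|h_t(y)|$, $e^{\theta^Th(y)}w(y)|h_t(y)h_{t'}(y)|$, $e^{\theta^Th(y)}w(y)|h_t(y)h_s(y)h_{s'}(y)|$. Let $$\mathcal I^*(\theta)=\mathbb E_{q^*}[r\,w\,hh^T]-\tfrac1{\mathbb E_{p^*}[w]}\mathbb E_{q^*}[r\,w\,h]\,\mathbb E_{q^*}[r\,w\,h]^T,\quad r=r(\cdot;\theta,C^*_\theta),\qquad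 \mathcal I^*=\mathcal I^*(\theta^*).$$ **Assumptions.** 1. $0<w(x)\le W_{\max}$ for all $x$, and $\mathbb E_{p^*}[w]\ge W_{\min}>0$. 2. For all $\theta\in\Theta$: $e^{\theta^Th(x)}w(x)\le E_{\max}$ for all $x$, and $\mathbb E_{q^*}[e^{\theta^Th}w]\ge E_{\min}>0$. 3. For all $\theta\in\Theta$, all $t$ and all $x$, the entries of $hw$, $h\,e^{\theta^Th}w$, $hh^Te^{\theta^Th}w$ and $h_th_Sh_S^Te^{\theta^Th}w$ are at most $D_{\max}$ in absolute value. 4. $\Lambda_{\min}[\mathcal I^*_{SS}]\ge\lambda_{\min}>0$. 5. If $\mathcal I^*_{SS}$ is invertible, $\|\mathcal I^*_{S^cS}(\mathcal I^*_{SS})^{-1}\|_\infty\le1-\alpha$ with $0<\alpha\le1$ (maximal absolute row sum). 6. $\|\partial_{\theta_t}\mathcal I^*_{SS}(\theta)\|_2\le\lambda_{3,\max}$ for all $\theta$ in the interior of $\Theta$ and all $t$. **Statement.** There are constants $L',N>0$ depending only on $W_{\min},W_{\max},E_{\min},E_{\max},D_{\max},\alpha,\bar\varepsilon$, a constant $c>0$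 depending only on these and on $\lambda_{\min},\lambda_{3,\max},\rho$, and for each $\delta\in(0,1)$ a constant $K>0$ depending only on all of these and $\delta$, such that the following holds for all $m,d,n_p^*,n_q^*,o_p,o_q$ and all data satisfying the above and $n^*_{p,q}\ge K\max\{1,k^3\log d\}$. Let $$\lambda=L'(1-\varepsilon_p)\sqrt{\frac{\log(6d/\delta)}{n^*_{p,q}}}+N\varepsilon\nu .$$ There is an event of probability at least $1-8\delta$ on which, whenever $$k^{3/2}\varepsilon\nu\le c\quad\text{and}\quad \min_{t\in S}|\theta^*_t|\ge\frac{80L'}{\lambda_{\min}}\sqrt{\frac{k\log(6d/\delta)}{n^*_{p,q}}}+\frac{80N}{\lambda_{\min}}\frac{\varepsilon\nu\sqrt k}{1-\varepsilon_p},$$ the estimator $\hat\theta$ exists and is unique (the same point is the unique minimizer over $\Theta$ and over $\mathbb R^d$), it is sparse-consistent, i.e. $\hat\theta_t\neq0$ for $t\in S$ and $\hat\theta_t=0$ for $t\notin S$, and $$\|\hat\theta-\theta^*\|_2\le\frac{40L'}{\lambda_{\min}}\sqrt{\frac{k\log(6d/\delta)}{n^*_{p,q}}}+\frac{40N}{\lambda_{\min}}\frac{\varepsilon\nu\sqrt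 k}{1-\varepsilon_p}.$$ -/

import Mathlib

open MeasureTheory ProbabilityTheory

noncomputable section

namespace WeightedDRE

/-- `ℝⁿ` with its Euclidean norm. -/
abbrev Vec (n : ℕ) := EuclideanSpace ℝ (Fin n)

/-- The data of a weighted density ratio estimation problem on `ℝᵐ` with a `d`-dimensional
parameter: the reference density `p`, the target density `q`, the feature transform `h`, the
weight function `w`, the parameter set `Θ` and the true parameter `θ₀`. -/
structure Setup (m d : ℕ) where
  p : Vec m → ℝ
  q : Vec m → ℝ
  h : Vec m → Vec d
  w : Vec m → ℝ
  Θ : Set (Vec d)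
  θ₀ : Vec d

namespace Setup

variable {m d : ℕ} (M : Setup m d)

/-- The reference distribution, with Lebesgue density `p`. -/
def P : Measure (Vec m) := volume.withDensity fun x => ENNReal.ofReal (M.p x)

/-- The target distribution, with Lebesgue density `q`. -/
def Q : Measure (Vec m) := volume.withDensity fun x => ENNReal.ofReal (M.q x)

/-- `exp (θᵀ h(x))`. -/
def expF (θ : Vec d) (x : Vec m) : ℝ := Real.exp (inner ℝ θ (M.h x))

/-- The parametric density ratio `r(x; θ, C) = C exp (θᵀ h(x))`. -/
def ratio (x : Vec m) (θ : Vec d) (C : ℝ) : ℝ := C * M.expF θ x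

/-- The population normalizing term `E_p[w] / E_q[exp (θᵀ h) w]`. -/
def normC (θ : Vec d) : ℝ := (∫ x, M.w x ∂M.P) / ∫ x, M.expF θ x * M.w x ∂M.Q

/-- The standing assumptions: `p`, `q` are probability densities, `h`, `w` are measurable, `Θ` is
compact and convex, `θ₀` is an interior point of `Θ`, and `p = r(·; θ₀, C_{θ₀}) q`. -/
structure IsValid : Prop where
  measurable_p : Measurable M.p
  measurable_q : Measurable M.q
  p_nonneg : ∀ x, 0 ≤ M.p x
  q_nonneg : ∀ x, 0 ≤ M.q x
  prob_P : IsProbabilityMeasure M.P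
  prob_Q : IsProbabilityMeasure M.Q
  measurable_h : Measurable M.h
  measurable_w : Measurable M.w
  isCompact_Θ : IsCompact M.Θ
  convex_Θ : Convex ℝ M.Θ
  interior_θ₀ : M.θ₀ ∈ interior M.Θ
  true_ratio : ∀ x, M.p x = M.ratio x M.θ₀ (M.normC M.θ₀) * M.q x

/-- The active set `S = {t | θ₀ t ≠ 0}`. -/
def S : Finset (Fin d) := Finset.univ.filter fun t => M.θ₀ t ≠ 0

/-- The number of nonzero true parameters. -/
def k : ℕ := M.S.card

/-! ### Boundedness assumptions -/

/-- `0 < w ≤ Wmax` and `E_p[w] ≥ Wmin`. -/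
def BoundedWeight (Wmin Wmax : ℝ) : Prop :=
  (∀ x, 0 < M.w x ∧ M.w x ≤ Wmax) ∧ Wmin ≤ ∫ x, M.w x ∂M.P

/-- `exp (θᵀ h) w ≤ Emax` and `E_q[exp (θᵀ h) w] ≥ Emin` for all `θ ∈ Θ`. -/
def BoundedRatio (Emin Emax : ℝ) : Prop :=
  ∀ θ ∈ M.Θ, (∀ x, M.expF θ x * M.w x ≤ Emax) ∧ Emin ≤ ∫ x, M.expF θ x * M.w x ∂M.Q

/-- Entrywise bounds by `Dmax` on `h w`, `h exp(θᵀ h) w`, `h hᵀ exp(θᵀ h) w` and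
`h_t h_S h_Sᵀ exp(θᵀ h) w` for all `θ ∈ Θ` and all indices `t`. -/
def BoundedFeatures (Dmax : ℝ) : Prop :=
  (∀ x t, |M.h x t * M.w x| ≤ Dmax) ∧
  ∀ θ ∈ M.Θ, ∀ x,
    (∀ t, |M.h x t * M.expF θ x * M.w x| ≤ Dmax) ∧
    (∀ t t', |M.h x t * M.h x t' * M.expF θ x * M.w x| ≤ Dmax) ∧
    (∀ t, ∀ i ∈ M.S, ∀ j ∈ M.S,
      |M.h x t * (M.h x i * M.h x j) * M.expF θ x * M.w x| ≤ Dmax)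

/-! ### The weighted Fisher information matrix and the assumptions on it -/

/-- The population weighted Fisher information matrix
`E_q[r w h hᵀ] - E_p[w]⁻¹ E_q[r w h] E_q[r w h]ᵀ`, where `r = r(·; θ, C_θ)`. -/
def fisher (θ : Vec d) : Matrix (Fin d) (Fin d) ℝ := Matrix.of fun i j =>
  (∫ x, M.ratio x θ (M.normC θ) * M.w x * (M.h x i * M.h x j) ∂M.Q)
    - 1 / (∫ x, M.w x ∂M.P) *
      ((∫ x, M.ratio x θ (M.normC θ) * M.w x * M.h x i ∂M.Q) *
        ∫ x, M.ratio x θ (M.normC θ) * M.w x * M.h x j ∂M.Q)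

/-- The `S × S` block of the Fisher information matrix. -/
def fisherSS (θ : Vec d) : Matrix M.S M.S ℝ :=
  (M.fisher θ).submatrix (fun i => (i : Fin d)) (fun j => (j : Fin d))

/-- The `Sᶜ × S` block of the Fisher information matrix. -/
def fisherScS (θ : Vec d) : Matrix (M.Sᶜ : Finset (Fin d)) M.S ℝ :=
  (M.fisher θ).submatrix (fun i => (i : Fin d)) (fun j => (j : Fin d))

/-- The entrywise partial derivative of the `S × S` block in the coordinate `θ_t`. -/
def dFisherSS (t : Fin d) (θ : Vec d) : Matrix M.S M.S ℝ := Matrix.of fun i j =>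
  lineDeriv ℝ (fun θ' => M.fisherSS θ' i j) θ (EuclideanSpace.single t (1 : ℝ))

/-- The smallest eigenvalue of the (symmetric) `S × S` block at `θ₀` is at least `lmin`, in the
Rayleigh quotient form. -/
def Dependency (lmin : ℝ) : Prop :=
  ∀ v : M.S → ℝ, lmin * (v ⬝ᵥ v) ≤ v ⬝ᵥ (M.fisherSS M.θ₀).mulVec v

/-- `‖I_{SᶜS} I_{SS}⁻¹‖_∞ ≤ 1 - α` at `θ₀` if `I_{SS}` is invertible, where `‖·‖_∞` is the largest
absolute row sum. -/
def Incoherence (α : ℝ) : Prop :=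
  IsUnit (M.fisherSS M.θ₀) →
    ∀ i, ∑ j, |(M.fisherScS M.θ₀ * (M.fisherSS M.θ₀)⁻¹) i j| ≤ 1 - α

/-- The spectral norm of `∇_t I_{SS}(θ)` is at most `l3`, for every `t` and every interior point
`θ` of `Θ` (where the derivative is two-sided). -/
def Smoothness (l3 : ℝ) : Prop :=
  ∀ θ ∈ interior M.Θ, ∀ t, ‖Matrix.toEuclideanCLM (𝕜 := ℝ) (M.dFisherSS t θ)‖ ≤ l3

end Setup

/-! ### Contaminated samples and the estimator -/

/-- A realization of the two contaminated datasets: `nP` inliers and `oP` outliers in the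
reference dataset, `nQ` inliers and `oQ` outliers in the target dataset. -/
structure Sample (m nP oP nQ oQ : ℕ) where
  inP : Fin nP → Vec m
  outP : Fin oP → Vec m
  inQ : Fin nQ → Vec m
  outQ : Fin oQ → Vec m

/-- The contamination ratio of a dataset with `n` inliers and `o` outliers. -/
def contamination (n o : ℕ) : ℝ := (o : ℝ) / ((n : ℝ) + (o : ℝ))

/-- The empirical mean of `f` over a dataset. -/
def empMean {m : ℕ} {ι : Type} [Fintype ι] (x : ι → Vec m) (f : Vec m → ℝ) : ℝ :=
  (∑ i, f (x i)) / (Fintype.card ι : ℝ)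

/-- `f` attains its minimum over `A` at `a` and at no other point of `A`. -/
def IsUniqueMinimizer {E : Type} (f : E → ℝ) (A : Set E) (a : E) : Prop :=
  a ∈ A ∧ ∀ b ∈ A, b ≠ a → f a < f b

namespace Sample

variable {m d nP oP nQ oQ : ℕ} (s : Sample m nP oP nQ oQ)

/-- The contaminated reference dataset. -/
def dataP : Fin nP ⊕ Fin oP → Vec m := Sum.elim s.inP s.outP

/-- The contaminated target dataset. -/
def dataQ : Fin nQ ⊕ Fin oQ → Vec m := Sum.elim s.inQ s.outQ

/-- The contaminated empirical objective
`-Ê_p[θᵀ h w] + Ê_p[w] log Ê_q[exp (θᵀ h) w]`. -/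
def loss (M : Setup m d) (θ : Vec d) : ℝ :=
  -empMean s.dataP (fun x => inner ℝ θ (M.h x) * M.w x)
    + empMean s.dataP M.w * Real.log (empMean s.dataQ fun x => M.expF θ x * M.w x)

/-- The `ℓ¹`-penalized objective. -/
def objective (M : Setup m d) (lam : ℝ) (θ : Vec d) : ℝ :=
  s.loss M θ + lam * ∑ t, |θ t|

/-! The maximal weighted values of the outliers. A maximum over an empty index set is `0`. -/

def nu1 (M : Setup m d) : ℝ := ⨆ j, M.w (s.outP j)

def nu2 (M : Setup m d) : ℝ :=
  ⨆ j, ⨆ θ : M.Θ, M.expF θ (s.outQ j) * M.w (s.outQ j)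

def nu3 (M : Setup m d) : ℝ :=
  ⨆ t : Fin d, ⨆ j, M.w (s.outP j) * |M.h (s.outP j) t|

def nu4 (M : Setup m d) : ℝ :=
  ⨆ t : Fin d, ⨆ j, ⨆ θ : M.Θ,
    M.expF θ (s.outQ j) * M.w (s.outQ j) * |M.h (s.outQ j) t|

def nu5 (M : Setup m d) : ℝ :=
  ⨆ t : Fin d, ⨆ t' : Fin d, ⨆ j, ⨆ θ : M.Θ,
    M.expF θ (s.outQ j) * M.w (s.outQ j) * |M.h (s.outQ j) t * M.h (s.outQ j) t'|

def nu6 (M : Setup m d) : ℝ :=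
  ⨆ t : Fin d, ⨆ t' : M.S, ⨆ t'' : M.S, ⨆ j, ⨆ θ : M.Θ,
    M.expF θ (s.outQ j) * M.w (s.outQ j) *
      |M.h (s.outQ j) t * M.h (s.outQ j) t' * M.h (s.outQ j) t''|

/-- `ν = max (ν₁, …, ν₆)`. -/
def nu (M : Setup m d) : ℝ :=
  max (s.nu1 M) (max (s.nu2 M) (max (s.nu3 M) (max (s.nu4 M) (max (s.nu5 M) (s.nu6 M)))))

end Sample

/-- `X` is an independent sample from `P`. -/
def IsIIDSample {Ω : Type*} [MeasurableSpace Ω] (μ : Measure Ω) {m n : ℕ}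
    (X : Fin n → Ω → Vec m) (P : Measure (Vec m)) : Prop :=
  (∀ i, Measurable (X i)) ∧ (∀ i, μ.map (X i) = P) ∧ iIndepFun X μ

end WeightedDRE

end

/-!
After division by `1 - ε_p` and up to a constant, the contaminated loss is
`-⟨b̂, θ⟩ + â log Ẑ(θ)`, where `â, b̂, Ẑ` are sums over the contaminated data divided by the number
of inliers. Its gradient is a ratio of empirical moments of the tilted features. The inliers deviate
from their expectations by `O(√(log (d / δ) / n))` (Hoeffding and a union bound), and the outliers
contribute at most `ε ν / (1 - ε)` to each moment, so every moment at `θ₀` is within some `η` of its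
population value, and the regularization is a fixed multiple of `(1 - ε_p) η`.

The argument is a primal-dual witness. The penalized problem restricted to vectors supported on the
active set has a minimizer near `θ₀`; stationarity on the active coordinates and incoherence make it
strictly dual feasible on the others, and convexity makes it the unique global minimizer
(`exists_unique_lasso_minimizer`). All that is needed of the loss is that its gradient at `θ₀ + u`
equals the Fisher information applied to `u`, up to a small multiple of the regularization `lam`,
uniformly over `‖u‖ = O(√k lam)` (`Setup.abs_logLossGrad_sub_le`).

No uniform law over `θ` is used. The moments are expanded to second order at `θ₀`, where they
concentrate; the quadratic term of the population gradient is the third cumulant, which is the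
derivative of the Fisher information and is controlled in spectral norm, for inactive coordinates as
well (`Setup.abs_thirdCumulant_le`). The cubic remainder is at most a constant times `‖u‖₁ ^ 3`
(`Setup.abs_tilt_sub_taylor_le`): fourth-order moments are bounded because the bounds on the
third-order ones hold on a whole ball of radius `ρ` around `θ₀`. As `‖u‖₁ = O(k lam)`, the cubic term
is `O((k ^ (3 / 2) lam) ^ 2 lam)`, which explains the sample size `k ^ 3 log d`.
-/

namespace WeightedDRE

/-! ### The primal-dual witness argument -/

/-- A vector has `ℓ¹` norm on `S` at most `√|S|` times its Euclidean norm. -/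
lemma sum_abs_le_sqrt_card_mul_norm {d : ℕ} (S : Finset (Fin d)) (u : Vec d) :
    ∑ t ∈ S, |u t| ≤ √(S.card : ℝ) * ‖u‖ := by
  have h1 : (∑ t ∈ S, |u t|) ^ 2 ≤ S.card * ∑ t ∈ S, |u t| ^ 2 := sq_sum_le_card_mul_sum_sq
  have h2 : ∑ t ∈ S, |u t| ^ 2 ≤ ‖u‖ ^ 2 := by
    rw [EuclideanSpace.norm_sq_eq]
    simp only [Real.norm_eq_abs]
    exact Finset.sum_le_sum_of_subset_of_nonneg (Finset.subset_univ _) fun _ _ _ => sq_nonneg _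
  refine abs_le_of_sq_le_sq' ?_ (by positivity) |>.2
  rw [mul_pow, Real.sq_sqrt (by positivity)]
  exact h1.trans (by gcongr)

lemma sum_eq_sum_of_support {d : ℕ} {S : Finset (Fin d)} {u : Vec d} (hu : ∀ t ∉ S, u t = 0)
    (g : Fin d → ℝ) : ∑ t, g t * u t = ∑ t ∈ S, g t * u t := by
  refine (Finset.sum_subset (Finset.subset_univ S) fun t _ ht => ?_).symm
  rw [hu t ht, mul_zero]

/-- At a minimizer of `F` the slope in every feasible direction is nonnegative. The gradient
inequality and continuity of the gradient field replace differentiability. -/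
lemma directional_nonneg_of_minimizer {d : ℕ} {F : Vec d → ℝ} {G : Vec d → Fin d → ℝ}
    (hG : ∀ t, Continuous fun θ => G θ t)
    (hconv : ∀ θ v, F θ + ∑ t, G θ t * v t ≤ F (θ + v))
    {u v : Vec d} {τ₀ : ℝ} (hτ₀ : 0 < τ₀)
    (hmin : ∀ τ, 0 < τ → τ < τ₀ → F u ≤ F (u + τ • v)) :
    0 ≤ ∑ t, G u t * v t := by
  have hcont : Continuous fun τ : ℝ => ∑ t, G (u + τ • v) t * v t := by
    refine continuous_finsetSum _ fun t _ => ?_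
    exact ((hG t).comp (by fun_prop : Continuous fun τ : ℝ => u + τ • v)).mul continuous_const
  have hlim : Filter.Tendsto (fun τ : ℝ => ∑ t, G (u + τ • v) t * v t)
      (nhdsWithin 0 (Set.Ioi 0)) (nhds (∑ t, G u t * v t)) := by
    have := (hcont.tendsto 0).mono_left (nhdsWithin_le_nhds (s := Set.Ioi 0))
    simpa using this
  refine ge_of_tendsto hlim ?_
  filter_upwards [Ioo_mem_nhdsGT hτ₀] with τ hτ
  have h1 := hconv (u + τ • v) (-(τ • v))
  have h2 := hmin τ hτ.1 hτ.2
  have h3 : ∑ t, G (u + τ • v) t * (-(τ • v)) t = -(τ * ∑ t, G (u + τ • v) t * v t) := by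
    rw [Finset.mul_sum, ← Finset.sum_neg_distrib]
    refine Finset.sum_congr rfl fun t _ => ?_
    simp only [PiLp.neg_apply, PiLp.smul_apply, smul_eq_mul]
    ring
  rw [h3] at h1
  simp only [add_neg_cancel_right] at h1
  have h4 : 0 ≤ τ * ∑ t, G (u + τ • v) t * v t := by linarith
  exact nonneg_of_mul_nonneg_right h4 hτ.1

/-- **Primal-dual witness.** Let `f` be convex with continuous gradient field `G`, and suppose that
every direction in which `f` is affine somewhere is a direction of constant slope. If near `θ₀`,
within the coordinate subspace of `S`, the gradient is `A (θ - θ₀)` up to a sup-norm error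
`(α / 4) lam`, where `A` is positive definite on that subspace and incoherent, then the
`ℓ¹`-penalized problem has a unique global minimizer, which is close to `θ₀` and has the same
support. -/
theorem exists_unique_lasso_minimizer {d : ℕ} {f : Vec d → ℝ} {G : Vec d → Fin d → ℝ}
    {θ₀ : Vec d} {S : Finset (Fin d)} {A : Fin d → Fin d → ℝ} {lmin lam α r : ℝ}
    (hf : Continuous f) (hG : ∀ t, Continuous fun θ => G θ t)
    (hconv : ∀ θ v, f θ + ∑ t, G θ t * v t ≤ f (θ + v))
    (hflat : ∀ θ v, f (θ + v) = f θ + ∑ t, G θ t * v t →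
      ∀ θ', ∑ t, G θ' t * v t = ∑ t, G θ t * v t)
    (hS : ∀ t ∉ S, θ₀ t = 0) (hlmin : 0 < lmin) (hlam : 0 < lam) (hα : 0 < α) (hα1 : α ≤ 1)
    (hr : r = 2 * √(S.card : ℝ) * lam / lmin) (hθ₀ : ∀ t ∈ S, r < |θ₀ t|)
    (happrox : ∀ u : Vec d, (∀ t ∉ S, u t = 0) → ‖u‖ ≤ r →
      ∀ t, |G (θ₀ + u) t - ∑ s, A t s * u s| ≤ α / 4 * lam)
    (hpos : ∀ v : Vec d, (∀ t ∉ S, v t = 0) → lmin * ‖v‖ ^ 2 ≤ ∑ t, (∑ s, A t s * v s) * v t)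
    (hinc : ∀ v : Vec d, (∀ t ∉ S, v t = 0) → ∀ β : ℝ, 0 ≤ β →
      (∀ t ∈ S, |∑ s, A t s * v s| ≤ β) → ∀ t ∉ S, |∑ s, A t s * v s| ≤ (1 - α) * β) :
    ∃ θ : Vec d, ‖θ - θ₀‖ ≤ r ∧ (∀ t ∈ S, θ t ≠ 0) ∧ (∀ t ∉ S, θ t = 0) ∧
      IsUniqueMinimizer (fun θ => f θ + lam * ∑ t, |θ t|) Set.univ θ := by
  classical
  have hr0 : 0 ≤ r := by rw [hr]; positivity
  set sg : Fin d → ℝ := fun t => if t ∈ S then (if 0 < θ₀ t then 1 else -1) else 0 with hsg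
  have hsg_abs : ∀ t, |sg t| ≤ 1 := by
    intro t; simp only [hsg]; split_ifs <;> simp
  have hsg_le : ∀ t x, sg t * x ≤ |x| := by
    intro t x
    calc sg t * x ≤ |sg t * x| := le_abs_self _
      _ = |sg t| * |x| := abs_mul _ _
      _ ≤ 1 * |x| := by gcongr; exact hsg_abs t
      _ = |x| := one_mul _
  have hcoord : ∀ (u : Vec d) t, |u t| ≤ ‖u‖ := fun u t => by
    simpa using PiLp.norm_apply_le u t
  have hsg_eq : ∀ u : Vec d, ‖u‖ ≤ r → ∀ t ∈ S, sg t * (θ₀ t + u t) = |θ₀ t + u t| ∧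
      θ₀ t + u t ≠ 0 := by
    intro u hu t ht
    have h1 : |u t| < |θ₀ t| := ((hcoord u t).trans hu).trans_lt (hθ₀ t ht)
    have h2 := abs_le.1 (le_refl |u t|)
    simp only [hsg, ht, if_true]
    split_ifs with h0
    · rw [abs_of_pos h0] at h1
      have : 0 < θ₀ t + u t := by linarith
      rw [abs_of_pos this]; exact ⟨by ring, this.ne'⟩
    · rw [abs_of_nonpos (not_lt.1 h0)] at h1
      have : θ₀ t + u t < 0 := by linarith
      rw [abs_of_neg this]; exact ⟨by ring, this.ne⟩
  -- On the ball the penalty is linear, so the restricted problem is smooth.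
  set F : Vec d → ℝ := fun u => f (θ₀ + u) + ∑ t, lam * sg t * u t with hF
  set H : Vec d → Fin d → ℝ := fun u t => G (θ₀ + u) t + lam * sg t with hH
  have hHc : ∀ t, Continuous fun u => H u t := fun t =>
    ((hG t).comp (continuous_const.add continuous_id)).add continuous_const
  have hFconv : ∀ u v, F u + ∑ t, H u t * v t ≤ F (u + v) := by
    intro u v
    have := hconv (θ₀ + u) v
    simp only [hF, hH, add_mul, PiLp.add_apply, mul_add, Finset.sum_add_distrib, ← add_assoc]
    linarith
  have hFcont : Continuous F := by
    refine (hf.comp (continuous_const.add continuous_id)).add ?_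
    exact continuous_finsetSum _ fun t _ => by fun_prop
  set K : Set (Vec d) := {u | (∀ t ∉ S, u t = 0) ∧ ‖u‖ ≤ r} with hK
  have hKc : IsCompact K := by
    have h1 : IsClosed K := by
      have e1 : K = (⋂ t : Fin d, {u : Vec d | t ∉ S → u t = 0}) ∩ {u | ‖u‖ ≤ r} := by
        ext u; simp [hK]
      rw [e1]
      refine IsClosed.inter (isClosed_iInter fun t => ?_) (isClosed_le continuous_norm
        continuous_const)
      by_cases ht : t ∈ S
      · simp [ht]
      · simpa [ht] using isClosed_eq (by fun_prop : Continuous fun u : Vec d => u t)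
          continuous_const
    refine (isCompact_closedBall (0 : Vec d) r).of_isClosed_subset h1 fun u hu => ?_
    simpa using hu.2
  obtain ⟨u, ⟨huS, hur⟩, humin⟩ := hKc.exists_isMinOn ⟨0, by simp [hK, hr0]⟩ hFcont.continuousOn
  have hFmin : ∀ v ∈ K, F u ≤ F v := fun v hv => humin hv
  have hdir : ∀ (v : Vec d) (τ₀ : ℝ), 0 < τ₀ → (∀ t ∉ S, v t = 0) →
      (∀ τ, 0 < τ → τ < τ₀ → ‖u + τ • v‖ ≤ r) → 0 ≤ ∑ t, H u t * v t := by
    intro v τ₀ hτ₀ hv hb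
    refine directional_nonneg_of_minimizer hHc hFconv hτ₀ fun τ h1 h2 => hFmin _ ⟨?_, hb τ h1 h2⟩
    intro t ht
    simp [huS t ht, hv t ht]
  set A' : Fin d → ℝ := fun t => ∑ s, A t s * u s with hA'
  have happ : ∀ t, |G (θ₀ + u) t - A' t| ≤ α / 4 * lam := happrox u huS hur
  have hℓ : ∑ t ∈ S, |u t| ≤ √(S.card : ℝ) * ‖u‖ := sum_abs_le_sqrt_card_mul_norm S u
  -- The minimizer is interior to the ball.
  have hint : S.Nonempty → ‖u‖ < r := by
    intro hne
    have hcard : (0 : ℝ) < √(S.card : ℝ) := Real.sqrt_pos.2 (by exact_mod_cast hne.card_pos)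
    have h1 := hdir (-u) 1 one_pos (fun t ht => by simp [huS t ht]) fun τ h0 h1 => by
      have : u + τ • -u = (1 - τ) • u := by module
      rw [this, norm_smul, Real.norm_of_nonneg (by linarith)]
      nlinarith [norm_nonneg u]
    have h2 : ∑ t, H u t * (-u) t = -∑ t, H u t * u t := by simp
    have h3 : ∑ t, H u t * u t =
        ∑ t, A' t * u t + ∑ t, (G (θ₀ + u) t - A' t + lam * sg t) * u t := by
      rw [← Finset.sum_add_distrib]
      exact Finset.sum_congr rfl fun t _ => by simp only [hH]; ring
    have h4 : -(5 / 4 * lam * ∑ t ∈ S, |u t|) ≤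
        ∑ t, (G (θ₀ + u) t - A' t + lam * sg t) * u t := by
      rw [sum_eq_sum_of_support huS]
      refine (abs_le.1 ?_).1
      refine (Finset.abs_sum_le_sum_abs _ _).trans ?_
      rw [Finset.mul_sum]
      refine Finset.sum_le_sum fun t _ => ?_
      rw [abs_mul]
      refine mul_le_mul_of_nonneg_right ?_ (abs_nonneg _)
      refine (abs_add_le _ _).trans ?_
      rw [abs_mul, abs_of_pos hlam]
      nlinarith [happ t, hsg_abs t]
    have h5 := hpos u huS
    have h6 : lmin * ‖u‖ ^ 2 ≤ 5 / 4 * lam * (√(S.card : ℝ) * ‖u‖) := by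
      have : 5 / 4 * lam * ∑ t ∈ S, |u t| ≤ 5 / 4 * lam * (√(S.card : ℝ) * ‖u‖) := by gcongr
      linarith
    rcases eq_or_lt_of_le hur with h | h
    · exfalso
      have hrpos : 0 < r := by rw [hr]; positivity
      rw [h] at h6
      have e : lmin * r = 2 * √(S.card : ℝ) * lam := by rw [hr]; field_simp
      have : lmin * r ^ 2 = 2 * √(S.card : ℝ) * lam * r := by rw [← e]; ring
      have h7 : 0 < √(S.card : ℝ) * lam * r := by positivity
      nlinarith
    · exact h
  have hstat : ∀ t ∈ S, G (θ₀ + u) t = -(lam * sg t) := by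
    intro t ht
    have hu := hint ⟨t, ht⟩
    have key : ∀ σ : ℝ, |σ| = 1 → 0 ≤ H u t * σ := by
      intro σ hσ
      have h1 := hdir (EuclideanSpace.single t σ) (r - ‖u‖) (by linarith)
        (fun s hs => by
          have : s ≠ t := fun h => hs (h ▸ ht)
          simp [this]) fun τ h0 h1 => by
          refine (norm_add_le _ _).trans ?_
          rw [norm_smul, PiLp.norm_single, Real.norm_eq_abs σ, hσ,
            Real.norm_of_nonneg h0.le]
          linarith
      rw [Finset.sum_eq_single t (fun s _ hs => by simp [hs]) (by simp)] at h1
      simpa using h1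
    have h1 := key 1 (by simp)
    have h2 := key (-1) (by simp)
    simp only [hH] at h1 h2
    linarith
  -- Strict dual feasibility off the support.
  have hdual : ∀ t ∉ S, |G (θ₀ + u) t| < lam := by
    intro t ht
    have h1 : ∀ s ∈ S, |A' s| ≤ lam + α / 4 * lam := by
      intro s hs
      have e : A' s = -(lam * sg s) - (G (θ₀ + u) s - A' s) := by rw [← hstat s hs]; ring
      rw [e]
      refine (abs_sub _ _).trans ?_
      rw [abs_neg, abs_mul, abs_of_pos hlam]
      nlinarith [happ s, hsg_abs s]
    have h2 := hinc u huS _ (by positivity) h1 t ht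
    have h3 := happ t
    have e : G (θ₀ + u) t = A' t + (G (θ₀ + u) t - A' t) := by ring
    have h4 : |G (θ₀ + u) t| ≤ (1 - α) * (lam + α / 4 * lam) + α / 4 * lam := by
      rw [e]; exact (abs_add_le _ _).trans (add_le_add h2 h3)
    have h5 : 0 < α * lam := by positivity
    have h6 : 0 ≤ α * (α * lam) := by positivity
    nlinarith
  refine ⟨θ₀ + u, by simpa using hur, fun t ht => by simpa using (hsg_eq u hur t ht).2,
    fun t ht => by simp [hS t ht, huS t ht], Set.mem_univ _, fun θ _ hθ => ?_⟩
  obtain ⟨v, rfl⟩ : ∃ v, θ = θ₀ + u + v := ⟨θ - (θ₀ + u), by abel⟩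
  have hv0 : v ≠ 0 := fun h => hθ (by simp [h])
  have hcv := hconv (θ₀ + u) v
  -- Optimality of each coordinate, strict off the support.
  have hterm : ∀ t, lam * |(θ₀ + u) t| ≤ G (θ₀ + u) t * v t + lam * |(θ₀ + u + v) t| ∧
      (t ∉ S → v t ≠ 0 → lam * |(θ₀ + u) t| < G (θ₀ + u) t * v t + lam * |(θ₀ + u + v) t|) := by
    intro t
    by_cases ht : t ∈ S
    · refine ⟨?_, fun h => absurd ht h⟩
      rw [hstat t ht]
      have h1 := (hsg_eq u hur t ht).1
      have h2 := hsg_le t (θ₀ t + u t + v t)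
      simp only [PiLp.add_apply]
      rw [← h1]
      nlinarith
    · have h0 : (θ₀ + u) t = 0 := by simp [hS t ht, huS t ht]
      have h1 : (θ₀ + u + v) t = v t := by simp [hS t ht, huS t ht]
      rw [h0, h1, abs_zero, mul_zero]
      have h2 : -(|G (θ₀ + u) t| * |v t|) ≤ G (θ₀ + u) t * v t := by
        rw [← abs_mul]; exact neg_abs_le _
      have h3 := hdual t ht
      constructor
      · nlinarith [abs_nonneg (v t)]
      · intro _ hv
        nlinarith [abs_pos.2 hv]
  have hsum_le : lam * ∑ t, |(θ₀ + u) t| ≤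
      ∑ t, G (θ₀ + u) t * v t + lam * ∑ t, |(θ₀ + u + v) t| := by
    rw [Finset.mul_sum, Finset.mul_sum, ← Finset.sum_add_distrib]
    exact Finset.sum_le_sum fun t _ => (hterm t).1
  by_cases hvS : ∀ t ∉ S, v t = 0
  · -- An affine direction inside the subspace would contradict positive definiteness.
    have hne : f (θ₀ + u + v) ≠ f (θ₀ + u) + ∑ t, G (θ₀ + u) t * v t := by
      intro h
      have hc := hflat _ _ h
      have hne : S.Nonempty := by
        by_contra hS0
        rw [Finset.not_nonempty_iff_eq_empty] at hS0
        refine hv0 (PiLp.ext fun t => ?_)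
        simpa using hvS t (by simp [hS0])
      have hcard : (0 : ℝ) < √(S.card : ℝ) := Real.sqrt_pos.2 (by exact_mod_cast hne.card_pos)
      have hvn : 0 < ‖v‖ := norm_pos_iff.2 hv0
      set τ := r / ‖v‖ with hτ
      have hrpos : 0 < r := by rw [hr]; positivity
      have hτ0 : 0 < τ := by positivity
      have hnorm : ‖τ • v‖ = r := by
        rw [norm_smul, Real.norm_of_nonneg hτ0.le, hτ]; field_simp
      have hτS : ∀ t ∉ S, (τ • v) t = 0 := fun t ht => by simp [hvS t ht]
      have h1 := happrox (τ • v) hτS hnorm.le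
      have h2 := happrox 0 (by simp) (by simpa using hr0)
      have h3 := hpos (τ • v) hτS
      have h4 : ∑ t, G (θ₀ + τ • v) t * v t = ∑ t, G (θ₀ + 0) t * v t := by
        rw [hc, hc (θ₀ + 0)]
      have h5 : ∑ t, (∑ s, A t s * (τ • v) s) * v t ≤ α / 2 * lam * ∑ t ∈ S, |v t| := by
        have e : ∑ t, (∑ s, A t s * (τ • v) s) * v t =
            ∑ t, (G (θ₀ + 0) t - (G (θ₀ + τ • v) t - ∑ s, A t s * (τ • v) s)) * v t := by
          have : ∀ t, (G (θ₀ + 0) t - (G (θ₀ + τ • v) t - ∑ s, A t s * (τ • v) s)) * v t =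
              (∑ s, A t s * (τ • v) s) * v t +
                (G (θ₀ + 0) t * v t - G (θ₀ + τ • v) t * v t) := fun t => by ring
          simp only [this]
          rw [Finset.sum_add_distrib, Finset.sum_sub_distrib, h4]
          ring
        rw [e, sum_eq_sum_of_support hvS, Finset.mul_sum]
        refine Finset.sum_le_sum fun t _ => (le_abs_self _).trans ?_
        rw [abs_mul]
        refine mul_le_mul_of_nonneg_right ((abs_sub _ _).trans ?_) (abs_nonneg _)
        have h6 := h2 t
        simp only [PiLp.zero_apply, mul_zero, Finset.sum_const_zero, sub_zero] at h6
        linarith [h1 t]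
      have h6 : ∑ t, (∑ s, A t s * (τ • v) s) * (τ • v) t =
          τ * ∑ t, (∑ s, A t s * (τ • v) s) * v t := by
        rw [Finset.mul_sum]
        refine Finset.sum_congr rfl fun t _ => ?_
        simp only [PiLp.smul_apply, smul_eq_mul]
        ring
      have h7 := sum_abs_le_sqrt_card_mul_norm S v
      rw [hnorm, h6] at h3
      have h8 : τ * ∑ t, (∑ s, A t s * (τ • v) s) * v t ≤
          τ * (α / 2 * lam * (√(S.card : ℝ) * ‖v‖)) := by
        refine mul_le_mul_of_nonneg_left (h5.trans ?_) hτ0.le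
        gcongr
      have h9 : τ * (α / 2 * lam * (√(S.card : ℝ) * ‖v‖)) = α / 2 * lam * √(S.card : ℝ) * r := by
        rw [hτ]; field_simp
      have e : lmin * r ^ 2 = 2 * √(S.card : ℝ) * lam * r := by
        have : lmin * r = 2 * √(S.card : ℝ) * lam := by rw [hr]; field_simp
        rw [← this]; ring
      have h10 : 0 < √(S.card : ℝ) * lam * r := by positivity
      nlinarith
    have hlt := lt_of_le_of_ne hcv (Ne.symm hne)
    show f (θ₀ + u) + lam * ∑ t, |(θ₀ + u) t| < f (θ₀ + u + v) + lam * ∑ t, |(θ₀ + u + v) t|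
    linarith
  · push Not at hvS
    obtain ⟨t₁, ht₁, hvt⟩ := hvS
    have hsum_lt : lam * ∑ t, |(θ₀ + u) t| <
        ∑ t, G (θ₀ + u) t * v t + lam * ∑ t, |(θ₀ + u + v) t| := by
      rw [Finset.mul_sum, Finset.mul_sum, ← Finset.sum_add_distrib]
      exact Finset.sum_lt_sum (fun t _ => (hterm t).1)
        ⟨t₁, Finset.mem_univ _, (hterm t₁).2 ht₁ hvt⟩
    show f (θ₀ + u) + lam * ∑ t, |(θ₀ + u) t| < f (θ₀ + u + v) + lam * ∑ t, |(θ₀ + u + v) t|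
    linarith

lemma inner_eq_sum {d : ℕ} (u v : Vec d) : inner ℝ u v = ∑ t, v t * u t := by
  simp [PiLp.inner_apply]

/-! ### The log-partition function of a finite weighted family -/

section LogPartition

variable {d : ℕ} {ι : Type} [Fintype ι] (c : ι → ℝ) (g : ι → Vec d)

/-- The partition function `∑ cᵢ exp ⟨θ, gᵢ⟩` of a weighted family of vectors, with an extra
factor `φᵢ` in each term; `φ = 1` is the partition function itself and `φᵢ = gᵢ t` its partial
derivative in `θ_t`. -/
noncomputable def tiltedSum (φ : ι → ℝ) (θ : Vec d) : ℝ := ∑ i, c i * φ i * Real.exp (inner ℝ θ (g i))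

lemma continuous_tiltedSum (φ : ι → ℝ) : Continuous (tiltedSum c g φ) := by
  unfold tiltedSum
  fun_prop

variable {c}

lemma sum_tiltedSum_mul (θ v : Vec d) :
    ∑ t, tiltedSum c g (fun i => g i t) θ * v t =
      ∑ i, c i * inner ℝ v (g i) * Real.exp (inner ℝ θ (g i)) := by
  simp only [tiltedSum, Finset.sum_mul, inner_eq_sum v, Finset.mul_sum]
  rw [Finset.sum_comm]
  exact Finset.sum_congr rfl fun i _ => Finset.sum_congr rfl fun t _ => by ring

/-- The smooth part of the objective, `-⟨b, θ⟩ + a log ∑ cᵢ exp ⟨θ, gᵢ⟩`. -/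
noncomputable def logLoss (c : ι → ℝ) (g : ι → Vec d) (a : ℝ) (b : Fin d → ℝ) (θ : Vec d) : ℝ :=
  -(∑ t, b t * θ t) + a * Real.log (tiltedSum c g 1 θ)

/-- The gradient of `logLoss`. -/
noncomputable def logLossGrad (c : ι → ℝ) (g : ι → Vec d) (a : ℝ) (b : Fin d → ℝ) (θ : Vec d) (t : Fin d) : ℝ :=
  -b t + a * (tiltedSum c g (fun i => g i t) θ / tiltedSum c g 1 θ)

variable {a : ℝ} (b : Fin d → ℝ)

lemma sum_logLossGrad_mul (θ v : Vec d) :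
    ∑ t, logLossGrad c g a b θ t * v t = -(∑ t, b t * v t) +
      a * ((∑ t, tiltedSum c g (fun i => g i t) θ * v t) / tiltedSum c g 1 θ) := by
  rw [Finset.sum_div, Finset.mul_sum, ← Finset.sum_neg_distrib, ← Finset.sum_add_distrib]
  exact Finset.sum_congr rfl fun t _ => by simp only [logLossGrad]; ring

variable [Nonempty ι]

lemma tiltedSum_one_pos (hc : ∀ i, 0 < c i) (θ : Vec d) : 0 < tiltedSum c g 1 θ := by
  refine Finset.sum_pos (fun i _ => ?_) Finset.univ_nonempty
  have := hc i
  simp only [Pi.one_apply]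
  positivity

/-- Tangent line bound for the log-partition function, with equality only if all `⟨v, gᵢ⟩` agree
with the slope. -/
lemma log_tiltedSum_add (hc : ∀ i, 0 < c i) (θ v : Vec d) {κ : ℝ}
    (hκ : κ = (∑ t, tiltedSum c g (fun i => g i t) θ * v t) / tiltedSum c g 1 θ) :
    Real.log (tiltedSum c g 1 θ) + κ ≤ Real.log (tiltedSum c g 1 (θ + v)) ∧
    (Real.log (tiltedSum c g 1 (θ + v)) = Real.log (tiltedSum c g 1 θ) + κ →
      ∀ i, inner ℝ v (g i) = κ) := by
  have hZ := tiltedSum_one_pos g hc θ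
  have hZ' := tiltedSum_one_pos g hc (θ + v)
  set e : ι → ℝ := fun i => c i * Real.exp (inner ℝ θ (g i)) with he
  have he0 : ∀ i, 0 < e i := fun i => mul_pos (hc i) (Real.exp_pos _)
  have hmean : ∑ i, e i * (inner ℝ v (g i) - κ + 1) = tiltedSum c g 1 θ := by
    have h1 : ∑ i, e i * inner ℝ v (g i) = κ * tiltedSum c g 1 θ := by
      rw [hκ, div_mul_cancel₀ _ hZ.ne', sum_tiltedSum_mul]
      exact Finset.sum_congr rfl fun i _ => by simp only [he]; ring
    have h2 : ∑ i, e i = tiltedSum c g 1 θ :=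
      Finset.sum_congr rfl fun i _ => by simp [he]
    simp only [mul_add, mul_sub, Finset.sum_add_distrib, Finset.sum_sub_distrib, h1, mul_one,
      ← Finset.sum_mul, h2]
    ring
  have hexp : tiltedSum c g 1 (θ + v) =
      Real.exp κ * ∑ i, e i * Real.exp (inner ℝ v (g i) - κ) := by
    rw [Finset.mul_sum]
    refine Finset.sum_congr rfl fun i _ => ?_
    simp only [he, Pi.one_apply, mul_one, inner_add_left, Real.exp_add, Real.exp_sub]
    field_simp
  have hterm : ∀ i, e i * (inner ℝ v (g i) - κ + 1) ≤ e i * Real.exp (inner ℝ v (g i) - κ) :=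
    fun i => mul_le_mul_of_nonneg_left (Real.add_one_le_exp _) (he0 i).le
  have hlog : Real.log (tiltedSum c g 1 θ) + κ =
      Real.log (Real.exp κ * tiltedSum c g 1 θ) := by
    rw [Real.log_mul (Real.exp_ne_zero _) hZ.ne', Real.log_exp, add_comm]
  constructor
  · rw [hlog, hexp]
    refine Real.log_le_log (by positivity) (mul_le_mul_of_nonneg_left ?_ (Real.exp_pos _).le)
    rw [← hmean]
    exact Finset.sum_le_sum fun i _ => hterm i
  · intro h
    by_contra! hne
    obtain ⟨i, hi⟩ := hne
    have hlt : tiltedSum c g 1 θ < ∑ i, e i * Real.exp (inner ℝ v (g i) - κ) := by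
      rw [← hmean]
      refine Finset.sum_lt_sum (fun i _ => hterm i) ⟨i, Finset.mem_univ _, ?_⟩
      exact mul_lt_mul_of_pos_left (Real.add_one_lt_exp (sub_ne_zero.2 hi)) (he0 i)
    have : Real.log (Real.exp κ * tiltedSum c g 1 θ) < Real.log (tiltedSum c g 1 (θ + v)) := by
      rw [hexp]
      exact Real.log_lt_log (by positivity) (mul_lt_mul_of_pos_left hlt (Real.exp_pos _))
    rw [← hlog, h] at this
    exact lt_irrefl _ this

lemma continuous_logLoss (hc : ∀ i, 0 < c i) : Continuous (logLoss c g a b) := by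
  unfold logLoss
  refine Continuous.add (by fun_prop) (continuous_const.mul ?_)
  exact (continuous_tiltedSum c g 1).log fun θ => (tiltedSum_one_pos g hc θ).ne'

lemma continuous_logLossGrad (hc : ∀ i, 0 < c i) (t : Fin d) :
    Continuous fun θ => logLossGrad c g a b θ t := by
  unfold logLossGrad
  refine continuous_const.add (continuous_const.mul ?_)
  exact (continuous_tiltedSum c g _).div (continuous_tiltedSum c g 1)
    fun θ => (tiltedSum_one_pos g hc θ).ne'

lemma logLoss_gradient_le (hc : ∀ i, 0 < c i) (ha : 0 < a) (θ v : Vec d) :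
    logLoss c g a b θ + ∑ t, logLossGrad c g a b θ t * v t ≤ logLoss c g a b (θ + v) := by
  have h := mul_le_mul_of_nonneg_left (log_tiltedSum_add g hc θ v rfl).1 ha.le
  rw [sum_logLossGrad_mul]
  simp only [logLoss, PiLp.add_apply, mul_add, Finset.sum_add_distrib] at h ⊢
  linarith

lemma logLoss_flat (hc : ∀ i, 0 < c i) (ha : 0 < a) (θ v : Vec d)
    (h : logLoss c g a b (θ + v) = logLoss c g a b θ + ∑ t, logLossGrad c g a b θ t * v t)
    (θ' : Vec d) :
    ∑ t, logLossGrad c g a b θ' t * v t = ∑ t, logLossGrad c g a b θ t * v t := by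
  have hk := (log_tiltedSum_add g hc θ v rfl).2
  rw [sum_logLossGrad_mul] at h
  simp only [logLoss, PiLp.add_apply, mul_add, Finset.sum_add_distrib] at h
  have h2 := hk (mul_left_cancel₀ ha.ne' (by rw [mul_add]; linarith))
  rw [sum_logLossGrad_mul, sum_logLossGrad_mul]
  congr 2
  set κ := (∑ t, tiltedSum c g (fun i => g i t) θ * v t) / tiltedSum c g 1 θ
  rw [sum_tiltedSum_mul, div_eq_iff (tiltedSum_one_pos g hc θ').ne', tiltedSum, Finset.mul_sum]
  refine Finset.sum_congr rfl fun i _ => ?_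
  rw [h2 i, Pi.one_apply]
  ring

end LogPartition

/-! ### Perturbation of a ratio of second-order expansions -/

/-- Third-order expansion of a logarithmic derivative. With `N = y + y₁ + y₂ / 2` and
`M = z + z₁ + z₂ / 2`, the quotient `a N / M` is `a y / z` plus its linear part `J` up to the third
cumulant `T` and a cubic term. -/
lemma ratio_expansion {a z y z₁ y₁ z₂ y₂ N M : ℝ} (hN : N = y + y₁ + y₂ / 2)
    (hMz : M = z + z₁ + z₂ / 2) (hz : z ≠ 0) (hM : M ≠ 0) :
    a * (N / M) - a * (y / z) - (a / z * y₁ - a / z ^ 2 * y * z₁) =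
      (z / 2 * (a * (y₂ / z - z₂ * y / z ^ 2 - 2 * y₁ * z₁ / z ^ 2 + 2 * z₁ ^ 2 * y / z ^ 3)) -
        1 / 2 * z₂ * (a / z * y₁ - a / z ^ 2 * y * z₁)) / M := by
  obtain rfl : y₂ = 2 * (N - y - y₁) := by linarith
  obtain rfl : z₂ = 2 * (M - z - z₁) := by linarith
  field_simp
  ring

/-- The gradient of the empirical loss against the linear part `J` of its population counterpart,
for empirical moments `â, b̂, Ẑ, Ŷ` and population moments bounded by `B`. -/
lemma abs_ratio_sub_linear_le {a ahat b bhat z y z₁ y₁ z₂ y₂ Z Y T J B e η E mm σ : ℝ}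
    (hB : 1 ≤ B) (he : 0 < e) (hη : 0 ≤ η) (hE : 0 ≤ E) (hσ0 : 0 ≤ σ) (hσ1 : σ ≤ 1) (hmm : 0 ≤ mm)
    (hσe : 2 * B * σ ≤ e / 2)
    (hb : b = a * (y / z)) (ha0 : 0 ≤ a) (haB : a ≤ B) (hze : e ≤ z) (hzB : z ≤ B) (hyB : |y| ≤ B)
    (hz₁ : |z₁| ≤ B * σ) (hy₁ : |y₁| ≤ B * σ) (hz₂ : |z₂| ≤ B * σ ^ 2) (hy₂ : |y₂| ≤ B * σ ^ 2)
    (hJ : J = a / z * y₁ - a / z ^ 2 * y * z₁)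
    (hT : T = a * (y₂ / z - z₂ * y / z ^ 2 - 2 * y₁ * z₁ / z ^ 2 + 2 * z₁ ^ 2 * y / z ^ 3))
    (hbh : |bhat - b| ≤ η) (hah : |ahat - a| ≤ η) (hZe : e / 4 ≤ Z) (hYB : |Y| ≤ B * mm)
    (hZE : |Z - (z + z₁ + z₂ / 2)| ≤ E) (hYE : |Y - (y + y₁ + y₂ / 2)| ≤ E) :
    |-bhat + ahat * (Y / Z) - J| ≤
      η + η * (4 * B * mm / e) + 48 * B ^ 2 / e ^ 2 * E + B / e * |T| +
        B * (B ^ 2 / e + B ^ 3 / e ^ 2) / e * σ ^ 3 := by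
  have hz : 0 < z := he.trans_le hze
  have hZ : 0 < Z := by linarith
  have hB0 : 0 < B := by linarith
  set N := y + y₁ + y₂ / 2 with hN
  set M := z + z₁ + z₂ / 2 with hMdef
  have hσ2 : σ ^ 2 ≤ σ := by nlinarith
  have hBσ2 : B * σ ^ 2 ≤ B * σ := by gcongr
  have hBσ1 : B * σ ≤ B := by nlinarith
  have hBσ : 0 ≤ B * σ := by positivity
  obtain ⟨hz₁l, hz₁u⟩ := abs_le.1 hz₁
  obtain ⟨hy₁l, hy₁u⟩ := abs_le.1 hy₁
  obtain ⟨hz₂l, hz₂u⟩ := abs_le.1 hz₂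
  obtain ⟨hy₂l, hy₂u⟩ := abs_le.1 hy₂
  obtain ⟨hyl, hyu⟩ := abs_le.1 hyB
  have hMe : e / 2 ≤ M := by rw [hMdef]; linarith
  have hM : 0 < M := by linarith
  have hMB : M ≤ 3 * B := by rw [hMdef]; linarith
  have hNB : |N| ≤ 3 * B := by rw [abs_le, hN]; constructor <;> linarith
  have hexp := ratio_expansion (a := a) hN hMdef hz.ne' hM.ne'
  rw [← hb, ← hJ, ← hT] at hexp
  have hsplit : -bhat + ahat * (Y / Z) - J =
      -(bhat - b) + (ahat - a) * (Y / Z) + a * (((Y - N) * M - N * (Z - M)) / (M * Z)) +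
        (z / 2 * T - 1 / 2 * z₂ * J) / M := by
    rw [← hexp]
    field_simp
    ring
  have t1 : |(ahat - a) * (Y / Z)| ≤ η * (4 * B * mm / e) := by
    rw [abs_mul]
    refine mul_le_mul hah ?_ (abs_nonneg _) hη
    rw [abs_div, abs_of_pos hZ, div_le_div_iff₀ hZ he]
    have : |Y| * e ≤ B * mm * e := by gcongr
    have h2 : B * mm * (e / 4) ≤ B * mm * Z := by gcongr
    linarith
  have t2 : |a * (((Y - N) * M - N * (Z - M)) / (M * Z))| ≤ 48 * B ^ 2 / e ^ 2 * E := by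
    rw [abs_mul, abs_of_nonneg ha0, abs_div, abs_of_pos (mul_pos hM hZ)]
    have h1 : |(Y - N) * M - N * (Z - M)| ≤ 6 * B * E := by
      refine (abs_sub _ _).trans ?_
      rw [abs_mul, abs_mul, abs_of_pos hM]
      have : |Y - N| * M ≤ E * (3 * B) := by gcongr
      have : |N| * |Z - M| ≤ 3 * B * E := by gcongr
      linarith
    have h2 : e / 2 * (e / 4) ≤ M * Z := by gcongr
    have h3 : |(Y - N) * M - N * (Z - M)| / (M * Z) ≤ 6 * B * E / (e / 2 * (e / 4)) := by
      gcongr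
    calc a * (|(Y - N) * M - N * (Z - M)| / (M * Z)) ≤ B * (6 * B * E / (e / 2 * (e / 4))) := by
          gcongr
      _ = 48 * B ^ 2 / e ^ 2 * E := by field_simp; ring
  have hJB : |J| ≤ (B ^ 2 / e + B ^ 3 / e ^ 2) * σ := by
    rw [hJ]
    refine (abs_sub _ _).trans ?_
    rw [abs_mul, abs_mul, abs_mul, abs_of_nonneg (div_nonneg ha0 hz.le),
      abs_of_nonneg (div_nonneg ha0 (sq_nonneg z))]
    have h1 : a / z * |y₁| ≤ B / e * (B * σ) := by gcongr
    have h2 : a / z ^ 2 * |y| * |z₁| ≤ B / e ^ 2 * B * (B * σ) := by gcongr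
    calc _ ≤ B / e * (B * σ) + B / e ^ 2 * B * (B * σ) := add_le_add h1 h2
      _ = _ := by field_simp
  have t3 : |(z / 2 * T - 1 / 2 * z₂ * J) / M| ≤
      B / e * |T| + B * (B ^ 2 / e + B ^ 3 / e ^ 2) / e * σ ^ 3 := by
    rw [abs_div, abs_of_pos hM]
    have h1 : |z / 2 * T - 1 / 2 * z₂ * J| ≤
        B / 2 * |T| + B * (B ^ 2 / e + B ^ 3 / e ^ 2) / 2 * σ ^ 3 := by
      refine (abs_sub _ _).trans ?_
      rw [abs_mul, abs_mul, abs_mul, abs_of_pos (half_pos hz)]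
      have h2 : z / 2 * |T| ≤ B / 2 * |T| := by gcongr
      have h3 : |1 / 2| * |z₂| * |J| ≤ 1 / 2 * (B * σ ^ 2) * ((B ^ 2 / e + B ^ 3 / e ^ 2) * σ) := by
        rw [abs_of_pos (by norm_num : (0 : ℝ) < 1 / 2)]
        gcongr
      calc _ ≤ _ := add_le_add h2 h3
        _ = _ := by ring
    calc _ ≤ (B / 2 * |T| + B * (B ^ 2 / e + B ^ 3 / e ^ 2) / 2 * σ ^ 3) / (e / 2) := by gcongr
      _ = _ := by field_simp
  rw [hsplit]
  have s1 := abs_add_le (-(bhat - b) + (ahat - a) * (Y / Z) +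
    a * (((Y - N) * M - N * (Z - M)) / (M * Z))) ((z / 2 * T - 1 / 2 * z₂ * J) / M)
  have s2 := abs_add_le (-(bhat - b) + (ahat - a) * (Y / Z))
    (a * (((Y - N) * M - N * (Z - M)) / (M * Z)))
  have s3 := abs_add_le (-(bhat - b)) ((ahat - a) * (Y / Z))
  rw [abs_neg] at s3
  linarith

/-! ### Exponentially tilted moments -/

namespace Setup

variable {m d : ℕ} (M : Setup m d)

/-- A coordinate of the feature map `h`, or the constant `1` for the index `none`. -/
def feat : Option (Fin d) → Vec m → ℝ
  | none, _ => 1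
  | some t, x => M.h x t

@[simp] lemma feat_none (x : Vec m) : M.feat none x = 1 := rfl

@[simp] lemma feat_some (t : Fin d) (x : Vec m) : M.feat (some t) x = M.h x t := rfl

/-- The weighted monomial `h_a h_b h_c exp(θᵀ h) w` of degree at most three in the features. -/
noncomputable def tilt (θ : Vec d) (a b c : Option (Fin d)) (x : Vec m) : ℝ :=
  M.feat a x * (M.feat b x * M.feat c x) * M.expF θ x * M.w x

/-- The population moment `E_q[h_a h_b h_c exp(θᵀ h) w]`. -/
noncomputable def mom (θ : Vec d) (a b c : Option (Fin d)) : ℝ := ∫ x, M.tilt θ a b c x ∂M.Q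

/-- All tilted monomials of degree at most three, with at least two of the indices in the active
set or absent, are bounded by `B` over `Θ`. -/
def TiltBound (B : ℝ) : Prop :=
  ∀ θ ∈ M.Θ, ∀ a, ∀ b ∈ M.S.insertNone, ∀ c ∈ M.S.insertNone, ∀ x, |M.tilt θ a b c x| ≤ B

variable {M}

lemma tilt_comm (θ : Vec d) (a b c : Option (Fin d)) (x : Vec m) :
    M.tilt θ a b c x = M.tilt θ b a c x := by
  simp only [tilt]; ring

lemma tilt_comm' (θ : Vec d) (a b c : Option (Fin d)) (x : Vec m) :
    M.tilt θ a b c x = M.tilt θ a c b x := by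
  simp only [tilt]; ring

lemma mom_comm (θ : Vec d) (a b c : Option (Fin d)) : M.mom θ a b c = M.mom θ b a c := by
  simp only [mom, tilt_comm θ a b c]

lemma mom_comm' (θ : Vec d) (a b c : Option (Fin d)) : M.mom θ a b c = M.mom θ a c b := by
  simp only [mom, tilt_comm' θ a b c]

lemma expF_pos (θ : Vec d) (x : Vec m) : 0 < M.expF θ x := Real.exp_pos _

lemma expF_add (θ u : Vec d) (x : Vec m) :
    M.expF (θ + u) x = M.expF θ x * Real.exp (inner ℝ u (M.h x)) := by
  simp only [expF, inner_add_left, Real.exp_add]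

/-- The three cases of monomials that appear in the target moments. -/
lemma feat_cases {P : Option (Fin d) → Option (Fin d) → Option (Fin d) → Prop}
    (hsymm : ∀ a b, P a none b → P a b none) (hnone : P none none none)
    (hone : ∀ t, P (some t) none none) (hone' : ∀ s ∈ M.S, P none none (some s))
    (htwo : ∀ t, ∀ s ∈ M.S, P (some t) none (some s))
    (htwo' : ∀ s ∈ M.S, ∀ s' ∈ M.S, P none (some s) (some s'))
    (hthree : ∀ t, ∀ s ∈ M.S, ∀ s' ∈ M.S, P (some t) (some s) (some s'))
    (a : Option (Fin d)) {b c : Option (Fin d)} (hb : b ∈ M.S.insertNone)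
    (hc : c ∈ M.S.insertNone) : P a b c := by
  rcases a with _ | t <;> rcases b with _ | s <;> rcases c with _ | s' <;>
    try simp only [Finset.some_mem_insertNone] at hb hc
  · exact hnone
  · exact hone' _ hc
  · exact hsymm _ _ (hone' _ hb)
  · exact htwo' _ hb _ hc
  · exact hone t
  · exact htwo t _ hc
  · exact hsymm _ _ (htwo t _ hb)
  · exact hthree t _ hb _ hc

lemma tiltBound_of_bounded {Wmin Wmax Emin Emax Dmax B : ℝ} (hw : M.BoundedWeight Wmin Wmax)
    (hr : M.BoundedRatio Emin Emax) (hD : M.BoundedFeatures Dmax) (hE : Emax ≤ B) (hDB : Dmax ≤ B) :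
    M.TiltBound B := by
  intro θ hθ a b hb c hc x
  obtain ⟨h1, h2, h3⟩ := hD.2 θ hθ x
  refine feat_cases (P := fun a b c => |M.tilt θ a b c x| ≤ B) ?_ ?_ ?_ ?_ ?_ ?_ ?_ a hb hc
  · intro a b h
    rwa [tilt_comm']
  · simp only [tilt, feat_none, one_mul]
    rw [abs_of_pos (mul_pos (expF_pos _ _) (hw.1 x).1)]
    exact ((hr θ hθ).1 x).trans hE
  · intro t
    simpa [tilt] using (h1 t).trans hDB
  · intro s _
    simpa [tilt] using (h1 s).trans hDB
  · intro t s _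
    simpa [tilt] using (h2 t s).trans hDB
  · intro s _ s' _
    simpa [tilt] using (h2 s s').trans hDB
  · intro t s hs s' hs'
    simpa [tilt] using (h3 t s hs s' hs').trans hDB

lemma measurable_tilt (hM : M.IsValid) (θ : Vec d) (a b c : Option (Fin d)) :
    Measurable (M.tilt θ a b c) := by
  have hh : ∀ t, Measurable fun x => M.h x t := fun t =>
    (by fun_prop : Measurable fun v : Vec d => v t).comp hM.measurable_h
  have hf : ∀ a, Measurable (M.feat a) := by
    rintro (_ | t)
    · exact measurable_const
    · exact hh t
  have he : Measurable (M.expF θ) :=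
    Real.measurable_exp.comp ((by fun_prop : Measurable fun v : Vec d => (inner ℝ θ v : ℝ)).comp
      hM.measurable_h)
  exact (((hf a).mul ((hf b).mul (hf c))).mul he).mul hM.measurable_w

lemma abs_mom_le {B : ℝ} (hM : M.IsValid) (hB : M.TiltBound B) {θ : Vec d} (hθ : θ ∈ M.Θ)
    (a : Option (Fin d)) {b c : Option (Fin d)} (hb : b ∈ M.S.insertNone)
    (hc : c ∈ M.S.insertNone) : |M.mom θ a b c| ≤ B := by
  have := hM.prob_Q
  have h := norm_integral_le_of_norm_le_const (μ := M.Q) (f := M.tilt θ a b c)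
    (Filter.Eventually.of_forall fun x => hB θ hθ a b hb c hc x)
  simpa [mom] using h

end Setup

/-! ### Domination of the outliers -/

lemma Sample.abs_tilt_outQ_le_nu {m d nP oP nQ oQ : ℕ} {M : Setup m d}
    (s : Sample m nP oP nQ oQ) {B : ℝ} (hB : M.TiltBound B) (hw : ∀ x, 0 < M.w x)
    {θ : Vec d} (hθ : θ ∈ M.Θ) {Dmax : ℝ} (hD : M.BoundedFeatures Dmax)
    (a : Option (Fin d)) {b c : Option (Fin d)}
    (hb : b ∈ M.S.insertNone) (hc : c ∈ M.S.insertNone) (j : Fin oQ) :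
    |M.tilt θ a b c (s.outQ j)| ≤ s.nu M := by
  set x := s.outQ j
  have hpos : ∀ θ' : Vec d, 0 < M.expF θ' x * M.w x := fun θ' =>
    mul_pos (Setup.expF_pos _ _) (hw x)
  have hkey : ∀ (θ' : Vec d) (z : ℝ), |z * M.expF θ' x * M.w x| = M.expF θ' x * M.w x * |z| := by
    intro θ' z
    rw [mul_assoc, abs_mul, abs_of_pos (hpos θ'), mul_comm]
  have hbdd : ∀ (z C : ℝ), (∀ θ' ∈ M.Θ, |z * M.expF θ' x * M.w x| ≤ C) →
      M.expF θ x * M.w x * |z| ≤ ⨆ θ' : M.Θ, M.expF θ' x * M.w x * |z| := by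
    intro z C hz
    refine le_ciSup_of_le ⟨C, ?_⟩ (⟨θ, hθ⟩ : M.Θ) le_rfl
    rintro _ ⟨θ', rfl⟩
    simpa only [hkey] using hz θ' θ'.2
  have h2 : ∀ t t' : Fin d, |M.h x t * M.h x t' * M.expF θ x * M.w x| ≤ s.nu M := by
    intro t t'
    rw [hkey]
    refine le_trans ?_ (le_max_of_le_right <| le_max_of_le_right <| le_max_of_le_right <|
      le_max_of_le_right <| le_max_left _ _)
    refine le_ciSup_of_le (Finite.bddAbove_range _) t <|
      le_ciSup_of_le (Finite.bddAbove_range _) t' <|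
      le_ciSup_of_le (Finite.bddAbove_range _) j <| hbdd _ Dmax fun θ' hθ' => ?_
    exact (hD.2 θ' hθ' x).2.1 t t'
  have h1 : ∀ t : Fin d, |M.h x t * M.expF θ x * M.w x| ≤ s.nu M := by
    intro t
    rw [hkey]
    refine le_trans ?_ (le_max_of_le_right <| le_max_of_le_right <| le_max_of_le_right <|
      le_max_left _ _)
    refine le_ciSup_of_le (Finite.bddAbove_range _) t <|
      le_ciSup_of_le (Finite.bddAbove_range _) j <| hbdd _ Dmax fun θ' hθ' => ?_
    exact (hD.2 θ' hθ' x).1 t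
  refine Setup.feat_cases (M := M) (P := fun a b c => |M.tilt θ a b c x| ≤ s.nu M)
    ?_ ?_ ?_ ?_ ?_ ?_ ?_ a hb hc
  · intro a b h
    rwa [Setup.tilt_comm']
  · have h := hbdd 1 B fun θ' hθ' => by
      simpa [Setup.tilt] using hB θ' hθ' none none (by simp) none (by simp) x
    simp only [Setup.tilt, Setup.feat_none, one_mul, abs_of_pos (hpos θ)]
    simp only [abs_one, mul_one] at h
    refine le_trans ?_ (le_max_of_le_right <| le_max_left _ _)
    exact le_ciSup_of_le (Finite.bddAbove_range _) j h
  · intro t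
    simpa [Setup.tilt] using h1 t
  · intro t _
    simpa [Setup.tilt] using h1 t
  · intro t t' _
    simpa [Setup.tilt] using h2 t t'
  · intro t _ t' _
    simpa [Setup.tilt] using h2 t t'
  · intro t t' ht' t'' ht''
    have h := hbdd (M.h x t * M.h x t' * M.h x t'') Dmax fun θ' hθ' => by
      simpa [mul_assoc] using (hD.2 θ' hθ' x).2.2 t t' ht' t'' ht''
    rw [← hkey] at h
    simp only [Setup.tilt, Setup.feat_some, ← mul_assoc (M.h x t)]
    refine h.trans (le_trans ?_ (le_max_of_le_right <| le_max_of_le_right <|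
      le_max_of_le_right <| le_max_of_le_right <| le_max_right _ _))
    exact le_ciSup_of_le (Finite.bddAbove_range _) t <|
      le_ciSup_of_le (Finite.bddAbove_range _) ⟨t', ht'⟩ <|
      le_ciSup_of_le (Finite.bddAbove_range _) ⟨t'', ht''⟩ <|
      le_ciSup_of_le (Finite.bddAbove_range _) j le_rfl

lemma Sample.w_outP_le_nu {m d nP oP nQ oQ : ℕ} (M : Setup m d)
    (s : Sample m nP oP nQ oQ) (j : Fin oP) : M.w (s.outP j) ≤ s.nu M :=
  le_max_of_le_left <| le_ciSup_of_le (Finite.bddAbove_range _) j le_rfl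

lemma Sample.abs_h_mul_w_outP_le_nu {m d nP oP nQ oQ : ℕ} {M : Setup m d} (hw : ∀ x, 0 < M.w x)
    (s : Sample m nP oP nQ oQ) (t : Fin d) (j : Fin oP) :
    |M.h (s.outP j) t * M.w (s.outP j)| ≤ s.nu M := by
  rw [abs_mul, abs_of_pos (hw _), mul_comm]
  refine le_max_of_le_right <| le_max_of_le_right <| le_max_of_le_left ?_
  exact le_ciSup_of_le (Finite.bddAbove_range _) t <|
    le_ciSup_of_le (Finite.bddAbove_range _) j le_rfl

/-- `ν ≥ 0`, also when there are no outliers. -/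
lemma Sample.nu_nonneg {m d nP oP nQ oQ : ℕ} {M : Setup m d} (hw : ∀ x, 0 < M.w x)
    (s : Sample m nP oP nQ oQ) : 0 ≤ s.nu M :=
  le_max_of_le_left <| Real.iSup_nonneg fun _ => (hw _).le

/-! ### Cubic Taylor remainder of the tilted features -/

lemma abs_exp_sub_taylor_two_le (x : ℝ) :
    |Real.exp x - (1 + x + x ^ 2 / 2)| ≤ |x| ^ 3 * (Real.exp x + Real.exp (-x)) := by
  have h := Complex.norm_exp_sub_sum_le_norm_mul_exp (x : ℂ) 3
  have e : Complex.exp x - ∑ k ∈ Finset.range 3, (x : ℂ) ^ k / k.factorial =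
      ((Real.exp x - (1 + x + x ^ 2 / 2) : ℝ) : ℂ) := by
    simp [Finset.sum_range_succ, Nat.factorial]
  rw [e, Complex.norm_real, Complex.norm_real, Real.norm_eq_abs, Real.norm_eq_abs] at h
  exact h.trans (by gcongr; exact Real.exp_abs_le x)

namespace Setup

variable {m d : ℕ} {M : Setup m d}

/-- Fourth-order monomials are bounded too: since the tilted third-order monomials stay bounded
when `θ` moves by `± ρ / 2` in a coordinate direction, an exponential moment of the extra factor
is available. -/
lemma abs_tilt_mul_abs_h_le {B ρ : ℝ} (hB : M.TiltBound B) (hρ : 0 < ρ)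
    (hball : Metric.ball M.θ₀ ρ ⊆ M.Θ) {u : Vec d} (hu : ‖u‖ < ρ / 2) (a : Option (Fin d))
    {b c : Option (Fin d)} (hb : b ∈ M.S.insertNone) (hc : c ∈ M.S.insertNone) (j : Fin d)
    (x : Vec m) : |M.tilt (M.θ₀ + u) a b c x| * |M.h x j| ≤ 2 / ρ * B := by
  set σ : ℝ := if 0 ≤ M.h x j then 1 else -1 with hσ
  have hσh : σ * M.h x j = |M.h x j| := by
    simp only [hσ]
    split_ifs with h
    · rw [abs_of_nonneg h, one_mul]
    · rw [abs_of_neg (not_le.1 h)]; ring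
  have hσ1 : |σ| = 1 := by simp only [hσ]; split_ifs <;> simp
  set v : Vec d := EuclideanSpace.single j (ρ / 2 * σ) with hv
  have hvn : ‖v‖ = ρ / 2 := by
    rw [hv, PiLp.norm_single, Real.norm_eq_abs, abs_mul, hσ1, abs_of_pos (by positivity), mul_one]
  have hinner : inner ℝ v (M.h x) = ρ / 2 * |M.h x j| := by
    rw [hv, EuclideanSpace.inner_single_left, ← hσh]
    simp [mul_assoc]
  have hmem : M.θ₀ + u + v ∈ M.Θ := by
    refine hball ?_
    rw [Metric.mem_ball, dist_eq_norm, add_assoc, add_sub_cancel_left]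
    exact (norm_add_le _ _).trans_lt (by rw [hvn]; linarith)
  have hbd := hB _ hmem a b hb c hc x
  have htilt : M.tilt (M.θ₀ + u + v) a b c x =
      M.tilt (M.θ₀ + u) a b c x * Real.exp (ρ / 2 * |M.h x j|) := by
    simp only [tilt, expF_add (M.θ₀ + u) v, hinner]; ring
  rw [htilt, abs_mul, abs_of_pos (Real.exp_pos _)] at hbd
  have hexp : |M.h x j| ≤ 2 / ρ * Real.exp (ρ / 2 * |M.h x j|) := by
    have h := Real.add_one_le_exp (ρ / 2 * |M.h x j|)
    have e : |M.h x j| = 2 / ρ * (ρ / 2 * |M.h x j|) := by field_simp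
    calc |M.h x j| = 2 / ρ * (ρ / 2 * |M.h x j|) := e
      _ ≤ _ := by gcongr; linarith
  calc |M.tilt (M.θ₀ + u) a b c x| * |M.h x j|
      ≤ |M.tilt (M.θ₀ + u) a b c x| * (2 / ρ * Real.exp (ρ / 2 * |M.h x j|)) := by gcongr
    _ = 2 / ρ * (|M.tilt (M.θ₀ + u) a b c x| * Real.exp (ρ / 2 * |M.h x j|)) := by ring
    _ ≤ 2 / ρ * B := by gcongr

/-- Second-order expansion of `h_a exp((θ₀ + u)ᵀ h) w` in a perturbation `u` supported on the
active set. -/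
lemma abs_tilt_sub_taylor_le {B ρ : ℝ} (hB : M.TiltBound B) (hρ : 0 < ρ)
    (hball : Metric.ball M.θ₀ ρ ⊆ M.Θ) {u : Vec d} (huS : ∀ t ∉ M.S, u t = 0)
    (hu : ‖u‖ < ρ / 2) (a : Option (Fin d)) (x : Vec m) :
    |M.tilt (M.θ₀ + u) a none none x - (M.tilt M.θ₀ a none none x +
      ∑ s ∈ M.S, u s * M.tilt M.θ₀ a (some s) none x +
      (∑ s ∈ M.S, ∑ s' ∈ M.S, u s * u s' * M.tilt M.θ₀ a (some s) (some s') x) / 2)| ≤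
      4 / ρ * B * (∑ s ∈ M.S, |u s|) ^ 3 := by
  set y : ℝ := inner ℝ u (M.h x) with hy
  have hysum : y = ∑ s ∈ M.S, u s * M.h x s := by
    rw [hy, inner_eq_sum, sum_eq_sum_of_support huS]
    exact Finset.sum_congr rfl fun s _ => mul_comm _ _
  set ψ := M.tilt M.θ₀ a none none x with hψ
  have e0 : M.tilt (M.θ₀ + u) a none none x = ψ * Real.exp y := by
    simp only [hψ, tilt, expF_add]; ring
  have e1 : ∑ s ∈ M.S, u s * M.tilt M.θ₀ a (some s) none x = ψ * y := by
    rw [hysum, Finset.mul_sum]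
    exact Finset.sum_congr rfl fun s _ => by
      simp only [hψ, tilt, feat_none, feat_some]; ring
  have e2 : ∑ s ∈ M.S, ∑ s' ∈ M.S, u s * u s' * M.tilt M.θ₀ a (some s) (some s') x =
      ψ * y ^ 2 := by
    rw [hysum, sq, Finset.sum_mul_sum, Finset.mul_sum]
    refine Finset.sum_congr rfl fun s _ => ?_
    rw [Finset.mul_sum]
    exact Finset.sum_congr rfl fun s' _ => by
      simp only [hψ, tilt, feat_none, feat_some]; ring
  have e3 : ψ * Real.exp y - (ψ + ψ * y + ψ * y ^ 2 / 2) =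
      ψ * (Real.exp y - (1 + y + y ^ 2 / 2)) := by ring
  rw [e0, e1, e2, e3, abs_mul]
  -- Each of the two exponentials `exp (± y)` is a tilt inside `Θ`.
  have hside : ∀ v : Vec d, ‖v‖ < ρ / 2 →
      |ψ| * (|y| ^ 3 * Real.exp (inner ℝ v (M.h x))) ≤ 2 / ρ * B * (∑ s ∈ M.S, |u s|) ^ 3 := by
    intro v hv
    have hyabs : |y| ≤ ∑ s ∈ M.S, |u s| * |M.h x s| := by
      rw [hysum]
      refine (Finset.abs_sum_le_sum_abs _ _).trans (le_of_eq ?_)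
      exact Finset.sum_congr rfl fun s _ => abs_mul _ _
    have h1 : |y| ^ 3 ≤ ∑ s ∈ M.S, ∑ s' ∈ M.S, ∑ j ∈ M.S,
        |u s| * |u s'| * |u j| * (|M.h x s| * |M.h x s'| * |M.h x j|) := by
      refine (pow_le_pow_left₀ (abs_nonneg _) hyabs 3).trans (le_of_eq ?_)
      rw [pow_succ, pow_two, Finset.sum_mul_sum, Finset.sum_mul]
      refine Finset.sum_congr rfl fun s _ => ?_
      rw [Finset.sum_mul]
      refine Finset.sum_congr rfl fun s' _ => ?_
      rw [Finset.mul_sum]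
      exact Finset.sum_congr rfl fun j _ => by ring
    have h2 : (∑ s ∈ M.S, |u s|) ^ 3 = ∑ s ∈ M.S, ∑ s' ∈ M.S, ∑ j ∈ M.S,
        |u s| * |u s'| * |u j| := by
      rw [pow_succ, pow_two, Finset.sum_mul_sum, Finset.sum_mul]
      refine Finset.sum_congr rfl fun s _ => ?_
      rw [Finset.sum_mul]
      refine Finset.sum_congr rfl fun s' _ => ?_
      rw [Finset.mul_sum]
    calc |ψ| * (|y| ^ 3 * Real.exp (inner ℝ v (M.h x)))
        ≤ |ψ| * ((∑ s ∈ M.S, ∑ s' ∈ M.S, ∑ j ∈ M.S,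
          |u s| * |u s'| * |u j| * (|M.h x s| * |M.h x s'| * |M.h x j|)) *
            Real.exp (inner ℝ v (M.h x))) := by gcongr
      _ = ∑ s ∈ M.S, ∑ s' ∈ M.S, ∑ j ∈ M.S, |u s| * |u s'| * |u j| *
          (|M.tilt (M.θ₀ + v) a (some s) (some s') x| * |M.h x j|) := by
          simp only [Finset.sum_mul, Finset.mul_sum]
          refine Finset.sum_congr rfl fun s _ => Finset.sum_congr rfl fun s' _ =>
            Finset.sum_congr rfl fun j _ => ?_
          simp only [hψ, tilt, feat_none, feat_some, expF_add, abs_mul, abs_one, Real.abs_exp]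
          ring
      _ ≤ ∑ s ∈ M.S, ∑ s' ∈ M.S, ∑ j ∈ M.S, |u s| * |u s'| * |u j| * (2 / ρ * B) := by
          refine Finset.sum_le_sum fun s hs => Finset.sum_le_sum fun s' hs' =>
            Finset.sum_le_sum fun j _ => mul_le_mul_of_nonneg_left ?_ (by positivity)
          exact abs_tilt_mul_abs_h_le hB hρ hball hv a (by simpa using hs) (by simpa using hs') j x
      _ = 2 / ρ * B * (∑ s ∈ M.S, |u s|) ^ 3 := by
          rw [h2]
          simp only [Finset.mul_sum]
          exact Finset.sum_congr rfl fun s _ => Finset.sum_congr rfl fun s' _ =>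
            Finset.sum_congr rfl fun j _ => by ring
  have hp := hside u hu
  have hn := hside (-u) (by rwa [norm_neg])
  rw [inner_neg_left] at hn
  rw [← hy] at hp hn
  calc |ψ| * |Real.exp y - (1 + y + y ^ 2 / 2)|
      ≤ |ψ| * (|y| ^ 3 * (Real.exp y + Real.exp (-y))) := by
        gcongr; exact abs_exp_sub_taylor_two_le y
    _ = |ψ| * (|y| ^ 3 * Real.exp y) + |ψ| * (|y| ^ 3 * Real.exp (-y)) := by ring
    _ ≤ 4 / ρ * B * (∑ s ∈ M.S, |u s|) ^ 3 := by
        have : 4 / ρ * B * (∑ s ∈ M.S, |u s|) ^ 3 = 2 / ρ * B * (∑ s ∈ M.S, |u s|) ^ 3 +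
          2 / ρ * B * (∑ s ∈ M.S, |u s|) ^ 3 := by ring
        linarith

end Setup

/-! ### The Fisher information and its derivative in terms of moments -/

namespace Setup

variable {m d : ℕ} {M : Setup m d}

lemma integral_expF_mul_w (θ : Vec d) :
    ∫ x, M.expF θ x * M.w x ∂M.Q = M.mom θ none none none := by
  simp [mom, tilt]

lemma fisher_eq_mom (θ : Vec d) (i j : Fin d) :
    M.fisher θ i j = M.normC θ * M.mom θ none (some i) (some j) - 1 / (∫ x, M.w x ∂M.P) *
      ((M.normC θ * M.mom θ none (some i) none) * (M.normC θ * M.mom θ none (some j) none)) := by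
  have h1 : ∀ i : Fin d, ∫ x, M.ratio x θ (M.normC θ) * M.w x * M.h x i ∂M.Q =
      M.normC θ * M.mom θ none (some i) none := by
    intro i
    rw [mom, ← integral_const_mul]
    refine integral_congr_ae (Filter.Eventually.of_forall fun x => ?_)
    simp only [ratio, tilt, feat_none, feat_some]; ring
  have h2 : ∫ x, M.ratio x θ (M.normC θ) * M.w x * (M.h x i * M.h x j) ∂M.Q =
      M.normC θ * M.mom θ none (some i) (some j) := by
    rw [mom, ← integral_const_mul]
    refine integral_congr_ae (Filter.Eventually.of_forall fun x => ?_)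
    simp only [ratio, tilt, feat_none, feat_some]; ring
  rw [fisher, Matrix.of_apply, h1, h1, h2]

/-- The Fisher information is the covariance of `h` under the tilted law, scaled by `E_p[w]`. -/
lemma fisher_eq {θ : Vec d} (ha : ∫ x, M.w x ∂M.P ≠ 0) (i j : Fin d) :
    M.fisher θ i j = (∫ x, M.w x ∂M.P) *
      (M.mom θ none (some i) (some j) / M.mom θ none none none -
        M.mom θ none (some i) none * M.mom θ none (some j) none / M.mom θ none none none ^ 2) := by
  rw [fisher_eq_mom, normC, integral_expF_mul_w]
  field_simp

/-- Integrals against `P` are tilted integrals against `Q`; applied to `h_t w` this says that the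
population loss is stationary at `θ₀`. -/
lemma integral_h_mul_w (hM : M.IsValid) (t : Fin d) :
    ∫ x, M.h x t * M.w x ∂M.P = (∫ x, M.w x ∂M.P) *
      (M.mom M.θ₀ (some t) none none / M.mom M.θ₀ none none none) := by
  have hP : ∫ x, M.h x t * M.w x ∂M.P = ∫ x, M.p x * (M.h x t * M.w x) := by
    rw [P, integral_withDensity_eq_integral_toReal_smul hM.measurable_p.ennreal_ofReal
      (Filter.Eventually.of_forall fun x => ENNReal.ofReal_lt_top)]
    simp only [ENNReal.toReal_ofReal (hM.p_nonneg _), smul_eq_mul]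
  have hQ : M.mom M.θ₀ (some t) none none = ∫ x, M.q x * M.tilt M.θ₀ (some t) none none x := by
    rw [mom, Q, integral_withDensity_eq_integral_toReal_smul hM.measurable_q.ennreal_ofReal
      (Filter.Eventually.of_forall fun x => ENNReal.ofReal_lt_top)]
    simp only [ENNReal.toReal_ofReal (hM.q_nonneg _), smul_eq_mul]
  have hC : M.normC M.θ₀ = (∫ x, M.w x ∂M.P) / M.mom M.θ₀ none none none := by
    rw [normC, integral_expF_mul_w]
  have e : (∫ x, M.w x ∂M.P) * (M.mom M.θ₀ (some t) none none / M.mom M.θ₀ none none none) =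
      M.normC M.θ₀ * M.mom M.θ₀ (some t) none none := by rw [hC]; ring
  rw [e, hP, hQ, ← integral_const_mul]
  refine integral_congr_ae (Filter.Eventually.of_forall fun x => ?_)
  simp only [hM.true_ratio x, ratio, tilt, feat_none, feat_some]
  ring

/-- Differentiating a moment in `θ_t` inserts the factor `h_t`. -/
lemma hasDerivAt_mom {B ρ : ℝ} (hM : M.IsValid) (hB : M.TiltBound B) (hρ : 0 < ρ)
    (hball : Metric.ball M.θ₀ ρ ⊆ M.Θ) (t : Fin d) {b c : Option (Fin d)}
    (hb : b ∈ M.S.insertNone) (hc : c ∈ M.S.insertNone) :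
    HasDerivAt (fun τ : ℝ => M.mom (M.θ₀ + τ • EuclideanSpace.single t (1 : ℝ)) none b c)
      (M.mom M.θ₀ (some t) b c) 0 := by
  have := hM.prob_Q
  have hin : ∀ x, inner ℝ (EuclideanSpace.single t (1 : ℝ)) (M.h x) = M.h x t := fun x => by
    simp [EuclideanSpace.inner_single_left]
  have hmem : ∀ τ ∈ Metric.ball (0 : ℝ) ρ, M.θ₀ + τ • EuclideanSpace.single t (1 : ℝ) ∈ M.Θ := by
    intro τ hτ
    refine hball ?_
    rw [Metric.mem_ball, dist_eq_norm, add_sub_cancel_left, norm_smul, PiLp.norm_single]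
    simpa using hτ
  have hint : ∀ τ ∈ Metric.ball (0 : ℝ) ρ, Integrable
      (M.tilt (M.θ₀ + τ • EuclideanSpace.single t (1 : ℝ)) none b c) M.Q := fun τ hτ =>
    Integrable.of_bound (measurable_tilt hM _ _ _ _).aestronglyMeasurable B
      (Filter.Eventually.of_forall fun x => hB _ (hmem τ hτ) none b hb c hc x)
  have h := (hasDerivAt_integral_of_dominated_loc_of_deriv_le (μ := M.Q) (x₀ := (0 : ℝ))
    (F := fun τ x => M.tilt (M.θ₀ + τ • EuclideanSpace.single t (1 : ℝ)) none b c x)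
    (F' := fun τ x => M.tilt (M.θ₀ + τ • EuclideanSpace.single t (1 : ℝ)) (some t) b c x)
    (bound := fun _ => B) (Metric.ball_mem_nhds 0 hρ)
    (Filter.Eventually.of_forall fun τ => (measurable_tilt hM _ _ _ _).aestronglyMeasurable)
    (hint 0 (Metric.mem_ball_self hρ)) (measurable_tilt hM _ _ _ _).aestronglyMeasurable
    (Filter.Eventually.of_forall fun x τ hτ => hB _ (hmem τ hτ) (some t) b hb c hc x)
    (integrable_const _) (Filter.Eventually.of_forall fun x τ _ => ?_)).2
  · simpa [mom] using h
  · have h1 : HasDerivAt (fun τ : ℝ => Real.exp (τ * M.h x t))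
        (Real.exp (τ * M.h x t) * (1 * M.h x t)) τ :=
      ((hasDerivAt_id τ).mul_const (M.h x t)).exp
    have h2 := h1.const_mul (M.feat b x * M.feat c x * M.expF M.θ₀ x * M.w x)
    have e : (fun τ : ℝ => M.tilt (M.θ₀ + τ • EuclideanSpace.single t (1 : ℝ)) none b c x) =
        fun τ => M.feat b x * M.feat c x * M.expF M.θ₀ x * M.w x * Real.exp (τ * M.h x t) := by
      funext τ
      simp only [tilt, expF_add, inner_smul_left, hin, feat_none, RCLike.conj_to_real]
      ring
    rw [e]
    refine h2.congr_deriv ?_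
    simp only [tilt, expF_add, inner_smul_left, hin, feat_some, RCLike.conj_to_real]
    ring

/-- The derivative of the Fisher information is the third cumulant of `h` under the tilted law. -/
lemma dFisherSS_eq {B ρ : ℝ} (hM : M.IsValid) (hB : M.TiltBound B) (hρ : 0 < ρ)
    (hball : Metric.ball M.θ₀ ρ ⊆ M.Θ) (ha : ∫ x, M.w x ∂M.P ≠ 0)
    (hz : M.mom M.θ₀ none none none ≠ 0) (t : Fin d) (i j : M.S) :
    M.dFisherSS t M.θ₀ i j = (∫ x, M.w x ∂M.P) *
      (M.mom M.θ₀ (some t) (some i) (some j) / M.mom M.θ₀ none none none -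
        M.mom M.θ₀ none (some i) (some j) * M.mom M.θ₀ (some t) none none /
          M.mom M.θ₀ none none none ^ 2 -
        (M.mom M.θ₀ (some t) (some i) none * M.mom M.θ₀ none (some j) none +
          M.mom M.θ₀ none (some i) none * M.mom M.θ₀ (some t) (some j) none) /
          M.mom M.θ₀ none none none ^ 2 +
        2 * M.mom M.θ₀ none (some i) none * M.mom M.θ₀ none (some j) none *
          M.mom M.θ₀ (some t) none none / M.mom M.θ₀ none none none ^ 3) := by
  have hi : some (i : Fin d) ∈ M.S.insertNone := by simp
  have hj : some (j : Fin d) ∈ M.S.insertNone := by simp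
  have hn : none ∈ M.S.insertNone := by simp
  have dz := hasDerivAt_mom hM hB hρ hball t hn hn
  have di := hasDerivAt_mom hM hB hρ hball t hi hn
  have dj := hasDerivAt_mom hM hB hρ hball t hj hn
  have dij := hasDerivAt_mom hM hB hρ hball t hi hj
  have e0 : M.θ₀ + (0 : ℝ) • EuclideanSpace.single t (1 : ℝ) = M.θ₀ := by simp
  have hz' : M.mom (M.θ₀ + (0 : ℝ) • EuclideanSpace.single t (1 : ℝ)) none none none ≠ 0 := by
    rwa [e0]
  have hd := ((dij.div dz hz').sub ((di.mul dj).div (dz.pow 2) (pow_ne_zero 2 hz'))).const_mul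
    (∫ x, M.w x ∂M.P)
  rw [dFisherSS, Matrix.of_apply, lineDeriv]
  simp only [fisherSS, Matrix.submatrix_apply, fisher_eq ha]
  refine HasDerivAt.deriv (hd.congr_deriv ?_)
  simp only [Pi.mul_apply, Pi.pow_apply, e0]
  field_simp
  ring

lemma fisher_quadratic_ge {lmin : ℝ} (hdep : M.Dependency lmin) {v : Vec d}
    (hv : ∀ t ∉ M.S, v t = 0) :
    lmin * ‖v‖ ^ 2 ≤ ∑ t, (∑ s, M.fisher M.θ₀ t s * v s) * v t := by
  have h := hdep fun s => v s
  have e1 : ((fun s : M.S => v s) ⬝ᵥ fun s : M.S => v s) = ‖v‖ ^ 2 := by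
    rw [EuclideanSpace.norm_sq_eq, dotProduct, Finset.sum_coe_sort M.S fun s => v s * v s,
      ← sum_eq_sum_of_support hv]
    exact Finset.sum_congr rfl fun s _ => by rw [Real.norm_eq_abs, sq_abs, sq]
  have e2 : (fun s : M.S => v s) ⬝ᵥ (M.fisherSS M.θ₀).mulVec (fun s : M.S => v s) =
      ∑ t, (∑ s, M.fisher M.θ₀ t s * v s) * v t := by
    rw [sum_eq_sum_of_support hv, dotProduct, ← Finset.sum_coe_sort M.S]
    refine Finset.sum_congr rfl fun t _ => ?_
    rw [mul_comm, sum_eq_sum_of_support hv, Matrix.mulVec, dotProduct, ← Finset.sum_coe_sort M.S]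
    rfl
  rwa [e1, e2] at h

lemma isUnit_fisherSS {lmin : ℝ} (hlmin : 0 < lmin) (hdep : M.Dependency lmin) :
    IsUnit (M.fisherSS M.θ₀) := by
  rw [← Matrix.mulVec_injective_iff_isUnit]
  intro v v' hvv
  have h0 : (M.fisherSS M.θ₀).mulVec (v - v') = 0 := by
    rw [Matrix.mulVec_sub]; exact sub_eq_zero.2 hvv
  have h := hdep (v - v')
  rw [h0, dotProduct_zero] at h
  have h1 : 0 ≤ (v - v') ⬝ᵥ (v - v') := by
    rw [dotProduct]; exact Finset.sum_nonneg fun i _ => mul_self_nonneg _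
  have h2 : (v - v') ⬝ᵥ (v - v') = 0 := by nlinarith
  exact sub_eq_zero.1 (dotProduct_self_eq_zero.1 h2)

/-- Incoherence transfers sup-norm bounds from the active rows of `I v` to the inactive ones. -/
lemma fisher_incoherent {lmin α : ℝ} (hlmin : 0 < lmin) (hdep : M.Dependency lmin)
    (hinc : M.Incoherence α) {v : Vec d} (hv : ∀ t ∉ M.S, v t = 0) {β : ℝ}
    (hβ0 : 0 ≤ β) (hβ : ∀ t ∈ M.S, |∑ s, M.fisher M.θ₀ t s * v s| ≤ β) {t : Fin d} (ht : t ∉ M.S) :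
    |∑ s, M.fisher M.θ₀ t s * v s| ≤ (1 - α) * β := by
  have hu := isUnit_fisherSS hlmin hdep
  have hi := hinc hu ⟨t, by simpa using ht⟩
  set vS : M.S → ℝ := fun s => v s with hvS
  have hrow : ∀ t, ∑ s, M.fisher M.θ₀ t s * v s = ∑ s : M.S, M.fisher M.θ₀ t s * vS s := by
    intro t
    rw [sum_eq_sum_of_support hv, ← Finset.sum_coe_sort M.S]
  have e1 : (M.fisherScS M.θ₀).mulVec vS =
      (M.fisherScS M.θ₀ * (M.fisherSS M.θ₀)⁻¹).mulVec ((M.fisherSS M.θ₀).mulVec vS) := by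
    rw [Matrix.mulVec_mulVec, Matrix.mul_assoc,
      Matrix.nonsing_inv_mul _ ((Matrix.isUnit_iff_isUnit_det _).1 hu), Matrix.mul_one]
  have e2 : ∑ s, M.fisher M.θ₀ t s * v s =
      ∑ j, (M.fisherScS M.θ₀ * (M.fisherSS M.θ₀)⁻¹) ⟨t, by simpa using ht⟩ j *
        (M.fisherSS M.θ₀).mulVec vS j := by
    rw [hrow]
    exact congrFun e1 ⟨t, by simpa using ht⟩
  rw [e2]
  refine (Finset.abs_sum_le_sum_abs _ _).trans ?_
  have h1 : ∀ j : M.S, |(M.fisherSS M.θ₀).mulVec vS j| ≤ β := by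
    intro j
    have := hβ j j.2
    rwa [hrow] at this
  calc _ ≤ ∑ j, |(M.fisherScS M.θ₀ * (M.fisherSS M.θ₀)⁻¹) ⟨t, by simpa using ht⟩ j| * β := by
        refine Finset.sum_le_sum fun j _ => ?_
        rw [abs_mul]
        exact mul_le_mul_of_nonneg_left (h1 j) (abs_nonneg _)
    _ ≤ (1 - α) * β := by
        rw [← Finset.sum_mul]
        exact mul_le_mul_of_nonneg_right hi hβ0

/-- The quadratic form of the third cumulant is controlled by the smoothness assumption at `θ₀`. -/
lemma abs_thirdCumulant_le {B ρ l3 : ℝ} (hM : M.IsValid) (hB : M.TiltBound B) (hρ : 0 < ρ)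
    (hball : Metric.ball M.θ₀ ρ ⊆ M.Θ) (ha : ∫ x, M.w x ∂M.P ≠ 0)
    (hz : M.mom M.θ₀ none none none ≠ 0) (hsm : M.Smoothness l3) {u : Vec d}
    (hu : ∀ t ∉ M.S, u t = 0) (t : Fin d) :
    |(∫ x, M.w x ∂M.P) *
      ((∑ i ∈ M.S, ∑ j ∈ M.S, u i * u j * M.mom M.θ₀ (some t) (some i) (some j)) /
          M.mom M.θ₀ none none none -
        (∑ i ∈ M.S, ∑ j ∈ M.S, u i * u j * M.mom M.θ₀ none (some i) (some j)) *
          M.mom M.θ₀ (some t) none none / M.mom M.θ₀ none none none ^ 2 -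
        2 * (∑ i ∈ M.S, u i * M.mom M.θ₀ (some t) (some i) none) *
          (∑ i ∈ M.S, u i * M.mom M.θ₀ none (some i) none) / M.mom M.θ₀ none none none ^ 2 +
        2 * (∑ i ∈ M.S, u i * M.mom M.θ₀ none (some i) none) ^ 2 *
          M.mom M.θ₀ (some t) none none / M.mom M.θ₀ none none none ^ 3)| ≤ l3 * ‖u‖ ^ 2 := by
  set uS : EuclideanSpace ℝ M.S := WithLp.toLp 2 fun s => u s with huS
  have hnorm : ‖uS‖ = ‖u‖ := by
    rw [EuclideanSpace.norm_eq, EuclideanSpace.norm_eq]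
    congr 1
    rw [Finset.sum_coe_sort M.S fun s => ‖u s‖ ^ 2]
    exact Finset.sum_subset (Finset.subset_univ _) fun s _ hs => by simp [hu s hs]
  have hop := hsm M.θ₀ (interior_maximal hball Metric.isOpen_ball (Metric.mem_ball_self hρ)) t
  have h1 : |inner ℝ uS (Matrix.toEuclideanCLM (𝕜 := ℝ) (M.dFisherSS t M.θ₀) uS)| ≤
      l3 * ‖u‖ ^ 2 := by
    refine (abs_real_inner_le_norm _ _).trans ?_
    calc _ ≤ ‖uS‖ * (l3 * ‖uS‖) := by
          gcongr
          exact (ContinuousLinearMap.le_opNorm _ _).trans (by gcongr)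
      _ = l3 * ‖u‖ ^ 2 := by rw [hnorm]; ring
  have h2 : inner ℝ uS (Matrix.toEuclideanCLM (𝕜 := ℝ) (M.dFisherSS t M.θ₀) uS) =
      ∑ i : M.S, ∑ j : M.S, u i * u j * M.dFisherSS t M.θ₀ i j := by
    rw [PiLp.inner_apply]
    refine Finset.sum_congr rfl fun i _ => ?_
    rw [huS, Matrix.toEuclideanCLM_toLp]
    simp only [Matrix.mulVec, dotProduct, RCLike.inner_apply, conj_trivial]
    rw [Finset.sum_mul]
    exact Finset.sum_congr rfl fun j _ => by ring
  rw [h2] at h1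
  refine le_trans (le_of_eq (congrArg _ ?_)) h1
  simp only [dFisherSS_eq hM hB hρ hball ha hz]
  set z := M.mom M.θ₀ none none none
  set y := M.mom M.θ₀ (some t) none none
  set a := ∫ x, M.w x ∂M.P
  rw [sq (∑ i ∈ M.S, u i * M.mom M.θ₀ none (some i) none), mul_assoc 2 (∑ i ∈ M.S, _),
    Finset.sum_mul_sum, Finset.sum_mul_sum]
  have s2 : ∀ f : Fin d → Fin d → ℝ, ∑ i ∈ M.S, ∑ j ∈ M.S, f i j =
      ∑ i : M.S, ∑ j : M.S, f i j := by
    intro f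
    rw [← Finset.sum_coe_sort M.S]
    exact Finset.sum_congr rfl fun i _ => by rw [← Finset.sum_coe_sort M.S]
  -- The two mixed terms agree after exchanging the summation indices.
  have hswap : ∑ i : M.S, ∑ j : M.S, u i * u j * (M.mom M.θ₀ none (some i) none *
      M.mom M.θ₀ (some t) (some j) none) = ∑ i : M.S, ∑ j : M.S, u i * u j *
      (M.mom M.θ₀ (some t) (some i) none * M.mom M.θ₀ none (some j) none) := by
    rw [Finset.sum_comm]
    exact Finset.sum_congr rfl fun i _ => Finset.sum_congr rfl fun j _ => by ring
  have hlin : ∀ i j : M.S, u i * u j * (a * (M.mom M.θ₀ (some t) (some i) (some j) / z -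
      M.mom M.θ₀ none (some i) (some j) * y / z ^ 2 -
      (M.mom M.θ₀ (some t) (some i) none * M.mom M.θ₀ none (some j) none +
        M.mom M.θ₀ none (some i) none * M.mom M.θ₀ (some t) (some j) none) / z ^ 2 +
      2 * M.mom M.θ₀ none (some i) none * M.mom M.θ₀ none (some j) none * y / z ^ 3)) =
      a / z * (u i * u j * M.mom M.θ₀ (some t) (some i) (some j)) -
      a * y / z ^ 2 * (u i * u j * M.mom M.θ₀ none (some i) (some j)) -
      a / z ^ 2 * (u i * u j *
        (M.mom M.θ₀ (some t) (some i) none * M.mom M.θ₀ none (some j) none)) -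
      a / z ^ 2 * (u i * u j *
        (M.mom M.θ₀ none (some i) none * M.mom M.θ₀ (some t) (some j) none)) +
      2 * a * y / z ^ 3 * (u i * M.mom M.θ₀ none (some i) none *
        (u j * M.mom M.θ₀ none (some j) none)) := fun i j => by ring
  have hpull : ∀ (r : ℝ) (f : M.S → M.S → ℝ), ∑ i, ∑ j, r * f i j = r * ∑ i, ∑ j, f i j := by
    intro r f
    simp only [Finset.mul_sum]
  simp only [hlin, Finset.sum_add_distrib, Finset.sum_sub_distrib, hpull, hswap, s2]
  have hre : ∀ i j : M.S, u i * M.mom M.θ₀ (some t) (some i) none *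
      (u j * M.mom M.θ₀ none (some j) none) = u i * u j *
      (M.mom M.θ₀ (some t) (some i) none * M.mom M.θ₀ none (some j) none) := fun i j => by ring
  simp only [hre]
  ring

end Setup

/-! ### The empirical gradient of a contaminated sample -/

section InlierMean

variable {m n o : ℕ}

/-- The sum of `f` over a contaminated dataset, divided by the number `n` of inliers only. This
normalization removes the factor `1 - ε` from all comparisons with population moments. -/
noncomputable def inlierMean (x : Fin n ⊕ Fin o → Vec m) (f : Vec m → ℝ) : ℝ :=
  (∑ i, f (x i)) / n

lemma inlierMean_add (x : Fin n ⊕ Fin o → Vec m) (f f' : Vec m → ℝ) :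
    inlierMean x (fun y => f y + f' y) = inlierMean x f + inlierMean x f' := by
  simp only [inlierMean, Finset.sum_add_distrib, add_div]

lemma inlierMean_sub (x : Fin n ⊕ Fin o → Vec m) (f f' : Vec m → ℝ) :
    inlierMean x (fun y => f y - f' y) = inlierMean x f - inlierMean x f' := by
  simp only [inlierMean, Finset.sum_sub_distrib, sub_div]

lemma inlierMean_const_mul (x : Fin n ⊕ Fin o → Vec m) (r : ℝ) (f : Vec m → ℝ) :
    inlierMean x (fun y => r * f y) = r * inlierMean x f := by
  simp only [inlierMean, ← Finset.mul_sum, mul_div_assoc]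

lemma inlierMean_sum {κ : Type*} (S : Finset κ) (x : Fin n ⊕ Fin o → Vec m)
    (f : κ → Vec m → ℝ) :
    inlierMean x (fun y => ∑ s ∈ S, f s y) = ∑ s ∈ S, inlierMean x (f s) := by
  simp only [inlierMean, ← Finset.sum_div]
  rw [Finset.sum_comm]

lemma inlierMean_mono (x : Fin n ⊕ Fin o → Vec m) {f f' : Vec m → ℝ} (h : ∀ y, f y ≤ f' y) :
    inlierMean x f ≤ inlierMean x f' :=
  div_le_div_of_nonneg_right (Finset.sum_le_sum fun _ _ => h _) n.cast_nonneg

lemma abs_inlierMean_le (x : Fin n ⊕ Fin o → Vec m) {f : Vec m → ℝ} {B : ℝ}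
    (h : ∀ y, |f y| ≤ B) : |inlierMean x f| ≤ B * (((n : ℝ) + o) / n) := by
  rw [inlierMean, abs_div, Nat.abs_cast, ← mul_div_assoc]
  refine div_le_div_of_nonneg_right ?_ n.cast_nonneg
  refine (Finset.abs_sum_le_sum_abs _ _).trans ((Finset.sum_le_sum fun _ _ => h _).trans ?_)
  simp [mul_comm]

lemma abs_inlierMean_sub_le (X : Fin n → Vec m) (Z : Fin o → Vec m) {f : Vec m → ℝ} {E τ C : ℝ}
    (hX : |empMean X f - E| ≤ τ) (hZ : ∀ j, |f (Z j)| ≤ C) :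
    |inlierMean (Sum.elim X Z) f - E| ≤ τ + (o : ℝ) / n * C := by
  have e : inlierMean (Sum.elim X Z) f - E = (empMean X f - E) + (∑ j, f (Z j)) / n := by
    simp only [inlierMean, empMean, Fintype.sum_sum_type, Sum.elim_inl, Sum.elim_inr,
      Fintype.card_fin]
    ring
  rw [e]
  refine (abs_add_le _ _).trans (add_le_add hX ?_)
  rw [abs_div, Nat.abs_cast, div_mul_eq_mul_div]
  refine div_le_div_of_nonneg_right ?_ n.cast_nonneg
  refine (Finset.abs_sum_le_sum_abs _ _).trans ((Finset.sum_le_sum fun _ _ => hZ _).trans ?_)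
  simp

lemma empMean_le_inlierMean (X : Fin n → Vec m) (Z : Fin o → Vec m) {f : Vec m → ℝ}
    (hZ : ∀ y, 0 ≤ f y) : empMean X f ≤ inlierMean (Sum.elim X Z) f := by
  simp only [inlierMean, empMean, Fintype.sum_sum_type, Sum.elim_inl, Sum.elim_inr,
    Fintype.card_fin]
  refine div_le_div_of_nonneg_right ?_ n.cast_nonneg
  exact le_add_of_nonneg_right (Finset.sum_nonneg fun _ _ => hZ _)

end InlierMean

namespace Setup

variable {m d : ℕ} {M : Setup m d} {n o : ℕ} {x : Fin n ⊕ Fin o → Vec m}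

/-- The second-order expansion of the empirical moments of `exp((θ₀ + u)ᵀ h) w` has coefficients
close to the population moments at `θ₀`. Only deviations at the single parameter `θ₀` enter. -/
lemma abs_inlierMean_tilt_sub_le {B ρ η mm : ℝ} (hB : M.TiltBound B) (hB0 : 0 ≤ B) (hρ : 0 < ρ)
    (hball : Metric.ball M.θ₀ ρ ⊆ M.Θ) (hmm : ((n : ℝ) + o) / n ≤ mm)
    (hdev : ∀ a, ∀ b ∈ M.S.insertNone, ∀ c ∈ M.S.insertNone,
      |inlierMean x (M.tilt M.θ₀ a b c) - M.mom M.θ₀ a b c| ≤ η) (hη : 0 ≤ η)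
    {u : Vec d} (huS : ∀ t ∉ M.S, u t = 0) (hu : ‖u‖ < ρ / 2) (hσ1 : ∑ s ∈ M.S, |u s| ≤ 1)
    (a : Option (Fin d)) :
    |inlierMean x (M.tilt (M.θ₀ + u) a none none) - (M.mom M.θ₀ a none none +
      ∑ s ∈ M.S, u s * M.mom M.θ₀ a (some s) none +
      (∑ s ∈ M.S, ∑ s' ∈ M.S, u s * u s' * M.mom M.θ₀ a (some s) (some s')) / 2)| ≤
      3 * η + 4 / ρ * B * mm * (∑ s ∈ M.S, |u s|) ^ 3 := by
  set σ := ∑ s ∈ M.S, |u s| with hσ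
  have hσ0 : 0 ≤ σ := Finset.sum_nonneg fun _ _ => abs_nonneg _
  have h1 := abs_inlierMean_le x (fun y => abs_tilt_sub_taylor_le hB hρ hball huS hu a y)
  rw [inlierMean_sub] at h1
  have h1' : |inlierMean x (M.tilt (M.θ₀ + u) a none none) - inlierMean x (fun y =>
      M.tilt M.θ₀ a none none y + ∑ s ∈ M.S, u s * M.tilt M.θ₀ a (some s) none y +
      (∑ s ∈ M.S, ∑ s' ∈ M.S, u s * u s' * M.tilt M.θ₀ a (some s) (some s') y) / 2)| ≤
      4 / ρ * B * mm * σ ^ 3 := by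
    refine h1.trans ?_
    calc _ ≤ 4 / ρ * B * σ ^ 3 * mm := by gcongr
      _ = _ := by ring
  have e : inlierMean x (fun y =>
      M.tilt M.θ₀ a none none y + ∑ s ∈ M.S, u s * M.tilt M.θ₀ a (some s) none y +
      (∑ s ∈ M.S, ∑ s' ∈ M.S, u s * u s' * M.tilt M.θ₀ a (some s) (some s') y) / 2) =
      inlierMean x (M.tilt M.θ₀ a none none) +
      ∑ s ∈ M.S, u s * inlierMean x (M.tilt M.θ₀ a (some s) none) +
      (∑ s ∈ M.S, ∑ s' ∈ M.S, u s * u s' *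
        inlierMean x (M.tilt M.θ₀ a (some s) (some s'))) / 2 := by
    have hdiv : ∀ f : Vec m → ℝ, inlierMean x (fun y => f y / 2) = inlierMean x f / 2 := by
      intro f
      simp only [inlierMean, ← Finset.sum_div]
      ring
    simp only [inlierMean_add, inlierMean_sum, inlierMean_const_mul, hdiv]
  have d0 := hdev a none (by simp) none (by simp)
  have d1 : |∑ s ∈ M.S, u s * inlierMean x (M.tilt M.θ₀ a (some s) none) -
      ∑ s ∈ M.S, u s * M.mom M.θ₀ a (some s) none| ≤ η * σ := by
    rw [← Finset.sum_sub_distrib, hσ, Finset.mul_sum]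
    refine (Finset.abs_sum_le_sum_abs _ _).trans (Finset.sum_le_sum fun s hs => ?_)
    rw [← mul_sub, abs_mul, mul_comm]
    exact mul_le_mul_of_nonneg_right (hdev a _ (by simpa using hs) none (by simp)) (abs_nonneg _)
  have d2 : |∑ s ∈ M.S, ∑ s' ∈ M.S, u s * u s' *
        inlierMean x (M.tilt M.θ₀ a (some s) (some s')) -
      ∑ s ∈ M.S, ∑ s' ∈ M.S, u s * u s' * M.mom M.θ₀ a (some s) (some s')| ≤ η * σ ^ 2 := by
    rw [← Finset.sum_sub_distrib, sq, hσ, Finset.sum_mul_sum, Finset.mul_sum]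
    refine (Finset.abs_sum_le_sum_abs _ _).trans (Finset.sum_le_sum fun s hs => ?_)
    rw [← Finset.sum_sub_distrib, Finset.mul_sum]
    refine (Finset.abs_sum_le_sum_abs _ _).trans (Finset.sum_le_sum fun s' hs' => ?_)
    rw [← mul_sub, abs_mul, abs_mul, mul_comm]
    exact mul_le_mul_of_nonneg_right (hdev a _ (by simpa using hs) _ (by simpa using hs'))
      (by positivity)
  rw [e] at h1'
  have hησ : η * σ ≤ η := mul_le_of_le_one_right hη hσ1
  have hησ2 : η * σ ^ 2 ≤ η := mul_le_of_le_one_right hη (pow_le_one₀ hσ0 hσ1)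
  rw [abs_le] at d0 d1 d2 h1' ⊢
  constructor <;> linarith [d0.1, d0.2, d1.1, d1.2, d2.1, d2.2, h1'.1, h1'.2]

/-- The empirical normalizing term stays bounded away from `0` near `θ₀`, by `exp y ≥ 1 + y`. -/
lemma inlierMean_tilt_ge {B e mm : ℝ} (hB : M.TiltBound B) (hB0 : 0 ≤ B)
    (hθ₀ : M.θ₀ ∈ M.Θ) (hw : ∀ x, 0 < M.w x) (hmm : ((n : ℝ) + o) / n ≤ mm)
    (hlow : e / 2 ≤ inlierMean x (M.tilt M.θ₀ none none none))
    {u : Vec d} (huS : ∀ t ∉ M.S, u t = 0) (hσ : B * mm * ∑ s ∈ M.S, |u s| ≤ e / 4) :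
    e / 4 ≤ inlierMean x (M.tilt (M.θ₀ + u) none none none) := by
  have h1 : ∀ y, M.tilt M.θ₀ none none none y +
      ∑ s ∈ M.S, u s * M.tilt M.θ₀ none (some s) none y ≤ M.tilt (M.θ₀ + u) none none none y := by
    intro y
    have e1 : ∑ s ∈ M.S, u s * M.tilt M.θ₀ none (some s) none y =
        M.tilt M.θ₀ none none none y * inner ℝ u (M.h y) := by
      rw [inner_eq_sum, sum_eq_sum_of_support huS, Finset.mul_sum]
      exact Finset.sum_congr rfl fun s _ => by simp only [tilt, feat_none, feat_some]; ring
    have e2 : M.tilt (M.θ₀ + u) none none none y =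
        M.tilt M.θ₀ none none none y * Real.exp (inner ℝ u (M.h y)) := by
      simp only [tilt, expF_add]; ring
    have hpos : 0 ≤ M.tilt M.θ₀ none none none y := by
      simp only [tilt, feat_none, one_mul]
      exact (mul_pos (expF_pos _ _) (hw y)).le
    rw [e1, e2]
    have := mul_le_mul_of_nonneg_left (Real.add_one_le_exp (inner ℝ u (M.h y))) hpos
    linarith
  have h2 := inlierMean_mono x h1
  rw [inlierMean_add, inlierMean_sum] at h2
  simp only [inlierMean_const_mul] at h2
  have h3 : |∑ s ∈ M.S, u s * inlierMean x (M.tilt M.θ₀ none (some s) none)| ≤ e / 4 := by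
    refine le_trans ?_ hσ
    rw [Finset.mul_sum]
    refine (Finset.abs_sum_le_sum_abs _ _).trans (Finset.sum_le_sum fun s hs => ?_)
    rw [abs_mul, mul_comm]
    refine mul_le_mul_of_nonneg_right ?_ (abs_nonneg _)
    refine (abs_inlierMean_le x fun y =>
      hB _ hθ₀ none _ (by simpa using hs) none (by simp) y).trans ?_
    gcongr
  linarith [(abs_le.1 h3).1]

lemma tiltedSum_one_eq (θ : Vec d) :
    tiltedSum (fun i => M.w (x i) / n) (fun i => M.h (x i)) 1 θ =
      inlierMean x (M.tilt θ none none none) := by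
  simp only [tiltedSum, inlierMean, Finset.sum_div]
  exact Finset.sum_congr rfl fun i _ => by
    simp only [tilt, feat_none, expF, Pi.one_apply]; ring

lemma tiltedSum_coord_eq (θ : Vec d) (t : Fin d) :
    tiltedSum (fun i => M.w (x i) / n) (fun i => M.h (x i)) (fun i => M.h (x i) t) θ =
      inlierMean x (M.tilt θ (some t) none none) := by
  simp only [tiltedSum, inlierMean, Finset.sum_div]
  exact Finset.sum_congr rfl fun i _ => by
    simp only [tilt, feat_none, feat_some, expF]; ring

/-- Near `θ₀`, the gradient of the empirical loss is the population Fisher information applied to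
the displacement, up to the deviation `η` of the moments, the population third cumulant, and a
cubic term. -/
lemma abs_logLossGrad_sub_le {Wmin B e ρ η mm l3 ahat : ℝ} {bhat : Fin d → ℝ}
    (hM : M.IsValid) (hB : M.TiltBound B) (hB1 : 1 ≤ B) (he : 0 < e) (hρ : 0 < ρ)
    (hball : Metric.ball M.θ₀ ρ ⊆ M.Θ) (hw : ∀ x, 0 < M.w x) (hWmin : 0 < Wmin)
    (ha : Wmin ≤ ∫ x, M.w x ∂M.P) (haB : ∫ x, M.w x ∂M.P ≤ B)
    (hz : e ≤ M.mom M.θ₀ none none none) (hsm : M.Smoothness l3)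
    (hmm0 : 0 ≤ mm) (hmm : ((n : ℝ) + o) / n ≤ mm) (hη : 0 ≤ η)
    (hdev : ∀ a, ∀ b ∈ M.S.insertNone, ∀ c ∈ M.S.insertNone,
      |inlierMean x (M.tilt M.θ₀ a b c) - M.mom M.θ₀ a b c| ≤ η)
    (hlow : e / 2 ≤ inlierMean x (M.tilt M.θ₀ none none none))
    (hahat : |ahat - ∫ x, M.w x ∂M.P| ≤ η)
    (hbhat : ∀ t, |bhat t - ∫ x, M.h x t * M.w x ∂M.P| ≤ η)
    {u : Vec d} (huS : ∀ t ∉ M.S, u t = 0) (hu : ‖u‖ < ρ / 2) {σ : ℝ}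
    (hσ : ∑ s ∈ M.S, |u s| = σ) (hσ1 : σ ≤ 1)
    (hσe : 2 * B * σ ≤ e / 2) (hσm : B * mm * σ ≤ e / 4) (t : Fin d) :
    |logLossGrad (fun i => M.w (x i) / n) (fun i => M.h (x i)) ahat bhat (M.θ₀ + u) t -
      ∑ s, M.fisher M.θ₀ t s * u s| ≤
      η + η * (4 * B * mm / e) + 48 * B ^ 2 / e ^ 2 * (3 * η + 4 / ρ * B * mm * σ ^ 3) +
        B / e * (l3 * ‖u‖ ^ 2) + B * (B ^ 2 / e + B ^ 3 / e ^ 2) / e * σ ^ 3 := by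
  have hB0 : 0 ≤ B := by linarith
  have hθ₀ : M.θ₀ ∈ M.Θ := hball (Metric.mem_ball_self hρ)
  have hθu : M.θ₀ + u ∈ M.Θ := hball (by
    rw [Metric.mem_ball, dist_eq_norm, add_sub_cancel_left]; linarith)
  have ha0 : 0 < ∫ x, M.w x ∂M.P := hWmin.trans_le ha
  have hz0 : 0 < M.mom M.θ₀ none none none := he.trans_le hz
  have hn : none ∈ M.S.insertNone := by simp
  have hσ0 : 0 ≤ σ := hσ ▸ Finset.sum_nonneg fun _ _ => abs_nonneg _
  have hlin : ∀ a, |∑ s ∈ M.S, u s * M.mom M.θ₀ a (some s) none| ≤ B * σ := by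
    intro a
    rw [← hσ, Finset.mul_sum]
    refine (Finset.abs_sum_le_sum_abs _ _).trans (Finset.sum_le_sum fun s hs => ?_)
    rw [abs_mul, mul_comm]
    exact mul_le_mul_of_nonneg_right (abs_mom_le hM hB hθ₀ a (by simpa using hs) hn) (abs_nonneg _)
  have hquad : ∀ a, |∑ s ∈ M.S, ∑ s' ∈ M.S, u s * u s' * M.mom M.θ₀ a (some s) (some s')| ≤
      B * σ ^ 2 := by
    intro a
    rw [← hσ, sq, Finset.sum_mul_sum, Finset.mul_sum]
    refine (Finset.abs_sum_le_sum_abs _ _).trans (Finset.sum_le_sum fun s hs => ?_)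
    rw [Finset.mul_sum]
    refine (Finset.abs_sum_le_sum_abs _ _).trans (Finset.sum_le_sum fun s' hs' => ?_)
    rw [abs_mul, abs_mul, mul_comm]
    exact mul_le_mul_of_nonneg_right (abs_mom_le hM hB hθ₀ a (by simpa using hs)
      (by simpa using hs')) (by positivity)
  have hJ : ∑ s, M.fisher M.θ₀ t s * u s = (∫ x, M.w x ∂M.P) / M.mom M.θ₀ none none none *
      (∑ s ∈ M.S, u s * M.mom M.θ₀ (some t) (some s) none) -
      (∫ x, M.w x ∂M.P) / M.mom M.θ₀ none none none ^ 2 * M.mom M.θ₀ (some t) none none *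
      (∑ s ∈ M.S, u s * M.mom M.θ₀ none (some s) none) := by
    rw [sum_eq_sum_of_support huS, Finset.mul_sum, Finset.mul_sum, ← Finset.sum_sub_distrib]
    refine Finset.sum_congr rfl fun s _ => ?_
    rw [fisher_eq ha0.ne', mom_comm M.θ₀ none (some t) none, mom_comm M.θ₀ none (some t) (some s),
      mom_comm' M.θ₀ (some t) none (some s)]
    ring
  have hcube : 0 ≤ 4 / ρ * B * mm * σ ^ 3 := by positivity
  have hexp := fun a => abs_inlierMean_tilt_sub_le hB hB0 hρ hball hmm hdev hη huS hu
    (hσ.trans_le hσ1) a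
  simp only [hσ] at hexp
  have hYB : |inlierMean x (M.tilt (M.θ₀ + u) (some t) none none)| ≤ B * mm :=
    (abs_inlierMean_le x fun y => hB _ hθu (some t) none hn none hn y).trans (by gcongr)
  have main := abs_ratio_sub_linear_le hB1 he hη (by linarith : 0 ≤ 3 * η + 4 / ρ * B * mm * σ ^ 3)
    hσ0 hσ1 hmm0 hσe (integral_h_mul_w hM t) ha0.le haB hz
    ((le_abs_self _).trans (abs_mom_le hM hB hθ₀ none hn hn))
    (abs_mom_le hM hB hθ₀ (some t) hn hn) (hlin none) (hlin (some t)) (hquad none)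
    (hquad (some t)) hJ rfl (hbhat t) hahat
    (inlierMean_tilt_ge hB hB0 hθ₀ hw hmm hlow huS (by rwa [hσ])) hYB (hexp none)
    (hexp (some t))
  rw [logLossGrad, tiltedSum_one_eq, tiltedSum_coord_eq]
  refine main.trans ?_
  have hT := abs_thirdCumulant_le hM hB hρ hball ha0.ne' hz0.ne' hsm huS t
  have := mul_le_mul_of_nonneg_left hT (by positivity : 0 ≤ B / e)
  linarith

end Setup

/-! ### Sparse recovery on a sample with small moment deviations -/

/-- The factor by which the regularization has to exceed the moment deviations. -/
noncomputable def regFactor (B e mm α : ℝ) : ℝ :=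
  8 * (1 + 4 * B * mm / e + 144 * B ^ 2 / e ^ 2) / α

/-- Smallness of `κ = k ^ (3 / 2) * lam`, which makes the estimation radius `2 √k lam / lmin` so
small that the quadratic and cubic parts of the gradient are dominated by the regularization. -/
structure IsSmall (B e mm α lmin l3 ρ κ : ℝ) : Prop where
  le_one : κ ≤ 1
  radius : 2 * κ / lmin < ρ / 2
  radius_le_one : 2 * κ / lmin ≤ 1
  normalizer : 2 * B * (2 * κ / lmin) ≤ e / 2
  normalizer' : B * mm * (2 * κ / lmin) ≤ e / 4
  remainder : κ * (8 * (48 * B ^ 2 / e ^ 2 * (4 / ρ * B * mm) +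
    B * (B ^ 2 / e + B ^ 3 / e ^ 2) / e) / lmin ^ 3 + 4 * (B / e * |l3|) / lmin ^ 2) ≤ α / 8

lemma exists_isSmall (B mm l3 : ℝ) {e α lmin ρ : ℝ} (he : 0 < e) (hα : 0 < α) (hρ : 0 < ρ) :
    ∃ c₀ : ℝ, 0 < c₀ ∧ ∀ κ, 0 ≤ κ → κ ≤ c₀ → IsSmall B e mm α lmin l3 ρ κ := by
  have key : ∀ (f : ℝ → ℝ) (b : ℝ), Continuous f → f 0 = 0 → 0 < b →
      ∀ᶠ κ in nhds (0 : ℝ), f κ < b := fun f b hf h0 hb =>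
    (hf.tendsto' 0 0 h0).eventually_lt_const hb
  have hev : ∀ᶠ κ in nhds (0 : ℝ), IsSmall B e mm α lmin l3 ρ κ := by
    filter_upwards [key (fun κ => κ) 1 (by fun_prop) rfl one_pos,
      key (fun κ => 2 * κ / lmin) (ρ / 2) (by fun_prop) (by simp) (by positivity),
      key (fun κ => 2 * κ / lmin) 1 (by fun_prop) (by simp) (by positivity),
      key (fun κ => 2 * B * (2 * κ / lmin)) (e / 2) (by fun_prop) (by simp) (by positivity),
      key (fun κ => B * mm * (2 * κ / lmin)) (e / 4) (by fun_prop) (by simp) (by positivity),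
      key (fun κ => κ * (8 * (48 * B ^ 2 / e ^ 2 * (4 / ρ * B * mm) +
        B * (B ^ 2 / e + B ^ 3 / e ^ 2) / e) / lmin ^ 3 + 4 * (B / e * |l3|) / lmin ^ 2)) (α / 8)
        (by fun_prop) (by simp) (by positivity)] with κ h1 h2 h3 h4 h5 h6
    exact ⟨h1.le, h2, h3.le, h4.le, h5.le, h6.le⟩
  obtain ⟨r, hr, h⟩ := Metric.eventually_nhds_iff.1 hev
  refine ⟨r / 2, by positivity, fun κ h0 hκ => h ?_⟩
  rw [Real.dist_eq, sub_zero, abs_of_nonneg h0]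
  linarith

lemma one_sub_contamination {n o : ℕ} (hn : 0 < n) :
    1 - contamination n o = (n : ℝ) / ((n : ℝ) + o) := by
  have : (0 : ℝ) < (n : ℝ) + o := by positivity
  rw [contamination]
  field_simp
  ring

lemma empMean_eq_mul_inlierMean {m n o : ℕ} (hn : 0 < n) (x : Fin n ⊕ Fin o → Vec m)
    (f : Vec m → ℝ) : empMean x f = (1 - contamination n o) * inlierMean x f := by
  have : (0 : ℝ) < n := by exact_mod_cast hn
  have : (0 : ℝ) < (n : ℝ) + o := by positivity
  rw [one_sub_contamination hn, empMean, inlierMean, Fintype.card_sum, Fintype.card_fin,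
    Fintype.card_fin, Nat.cast_add]
  field_simp

/-- Up to an additive constant, the penalized objective is `1 - ε_p` times a penalized
`logLoss`. -/
lemma Sample.objective_eq {m d nP oP nQ oQ : ℕ} (s : Sample m nP oP nQ oQ) (M : Setup m d)
    (hnP : 0 < nP) (hnQ : 0 < nQ) (hw : ∀ x, 0 < M.w x) (lam : ℝ) (θ : Vec d) :
    s.objective M ((1 - contamination nP oP) * lam) θ = (1 - contamination nP oP) *
      (logLoss (fun i => M.w (s.dataQ i) / nQ) (fun i => M.h (s.dataQ i))
        (inlierMean s.dataP M.w) (fun t => inlierMean s.dataP fun x => M.h x t * M.w x) θ +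
        lam * ∑ t, |θ t|) + (1 - contamination nP oP) * inlierMean s.dataP M.w *
          Real.log (1 - contamination nQ oQ) := by
  have hnQ' : (0 : ℝ) < nQ := by exact_mod_cast hnQ
  have : Nonempty (Fin nQ ⊕ Fin oQ) := ⟨Sum.inl ⟨0, hnQ⟩⟩
  have hpos : 0 < tiltedSum (fun i => M.w (s.dataQ i) / nQ) (fun i => M.h (s.dataQ i)) 1 θ :=
    tiltedSum_one_pos _ (fun i => div_pos (hw _) hnQ') θ
  have hq : 0 < 1 - contamination nQ oQ := by
    rw [one_sub_contamination hnQ]; positivity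
  have h1 : empMean s.dataQ (fun x => M.expF θ x * M.w x) = (1 - contamination nQ oQ) *
      tiltedSum (fun i => M.w (s.dataQ i) / nQ) (fun i => M.h (s.dataQ i)) 1 θ := by
    rw [Setup.tiltedSum_one_eq, empMean_eq_mul_inlierMean hnQ]
    congr 2
    funext x
    simp [Setup.tilt]
  have h2 : empMean s.dataP (fun x => inner ℝ θ (M.h x) * M.w x) = (1 - contamination nP oP) *
      ∑ t, inlierMean s.dataP (fun x => M.h x t * M.w x) * θ t := by
    rw [empMean_eq_mul_inlierMean hnP]
    congr 1
    have : (fun x => inner ℝ θ (M.h x) * M.w x) =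
        fun x => ∑ t, θ t * (M.h x t * M.w x) := by
      funext x
      rw [inner_eq_sum, Finset.sum_mul]
      exact Finset.sum_congr rfl fun t _ => by ring
    rw [this, inlierMean_sum]
    exact Finset.sum_congr rfl fun t _ => by rw [inlierMean_const_mul, mul_comm]
  rw [Sample.objective, Sample.loss, h1, h2, empMean_eq_mul_inlierMean hnP,
    Real.log_mul hq.ne' hpos.ne', logLoss]
  ring

/-- **Sparse recovery for one sample.** If all moments at `θ₀` deviate by at most `η` and the
regularization is `regFactor * η`, the penalized estimator exists, is unique, has the support of
`θ₀`, and is within `2 √k lam / lmin` of it. -/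
theorem Sample.exists_sparse_minimizer {m d nP oP nQ oQ : ℕ} (s : Sample m nP oP nQ oQ)
    {M : Setup m d} {Wmin B e ρ η mm lmin l3 α lam : ℝ}
    (hM : M.IsValid) (hB : M.TiltBound B) (hB1 : 1 ≤ B) (he : 0 < e) (hρ : 0 < ρ)
    (hball : Metric.ball M.θ₀ ρ ⊆ M.Θ) (hw : ∀ x, 0 < M.w x) (hWmin : 0 < Wmin)
    (ha : Wmin ≤ ∫ x, M.w x ∂M.P) (haB : ∫ x, M.w x ∂M.P ≤ B)
    (hz : e ≤ M.mom M.θ₀ none none none) (hlmin : 0 < lmin) (hα : 0 < α) (hα1 : α ≤ 1)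
    (hdep : M.Dependency lmin) (hinc : M.Incoherence α) (hsm : M.Smoothness l3)
    (hnP : 0 < nP) (hnQ : 0 < nQ) (hmm0 : 0 ≤ mm) (hmm : ((nQ : ℝ) + oQ) / nQ ≤ mm) (hη : 0 < η)
    (hdev : ∀ a, ∀ b ∈ M.S.insertNone, ∀ c ∈ M.S.insertNone,
      |inlierMean s.dataQ (M.tilt M.θ₀ a b c) - M.mom M.θ₀ a b c| ≤ η)
    (hlow : e / 2 ≤ inlierMean s.dataQ (M.tilt M.θ₀ none none none))
    (hahat : |inlierMean s.dataP M.w - ∫ x, M.w x ∂M.P| ≤ η)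
    (hbhat : ∀ t, |inlierMean s.dataP (fun x => M.h x t * M.w x) -
      ∫ x, M.h x t * M.w x ∂M.P| ≤ η)
    (hlam : lam = regFactor B e mm α * η)
    (hsmall : IsSmall B e mm α lmin l3 ρ (√(M.k : ℝ) * M.k * lam))
    (hθ₀ : ∀ t ∈ M.S, 2 * √(M.k : ℝ) * lam / lmin < |M.θ₀ t|) :
    ∃ θhat : Vec d,
      IsUniqueMinimizer (s.objective M ((1 - contamination nP oP) * lam)) M.Θ θhat ∧
      IsUniqueMinimizer (s.objective M ((1 - contamination nP oP) * lam)) Set.univ θhat ∧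
      (∀ t ∈ M.S, θhat t ≠ 0) ∧ (∀ t ∉ M.S, θhat t = 0) ∧
      ‖θhat - M.θ₀‖ ≤ 2 * √(M.k : ℝ) * lam / lmin := by
  have hB0 : 0 < B := by linarith
  have hnP' : (0 : ℝ) < nP := by exact_mod_cast hnP
  have hnQ' : (0 : ℝ) < nQ := by exact_mod_cast hnQ
  have : Nonempty (Fin nQ ⊕ Fin oQ) := ⟨Sum.inl ⟨0, hnQ⟩⟩
  have hlam0 : 0 < lam := by rw [hlam, regFactor]; positivity
  have hk0 : (0 : ℝ) ≤ M.k := Nat.cast_nonneg _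
  set q := √(M.k : ℝ) with hq
  have hq0 : 0 ≤ q := Real.sqrt_nonneg _
  have hqq : q * q = M.k := Real.mul_self_sqrt hk0
  set κ := q * M.k * lam with hκ
  have hκ0 : 0 ≤ κ := by positivity
  have hkcases : (M.k : ℝ) = 0 ∨ (1 : ℝ) ≤ M.k := by
    rcases Nat.eq_zero_or_pos M.k with h | h
    · left; exact_mod_cast h
    · right; exact_mod_cast h
  have hqk : q ≤ q * M.k ∧ (M.k : ℝ) ≤ q * M.k := by
    rcases hkcases with h | h
    · have : q = 0 := by rw [hq, h, Real.sqrt_zero]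
      simp [h, this]
    · have : 1 ≤ q := by rw [hq]; exact Real.one_le_sqrt.2 h
      constructor <;> nlinarith
  set r := 2 * q * lam / lmin with hr
  have hr0 : 0 ≤ r := by positivity
  have hrκ : r ≤ 2 * κ / lmin := by
    rw [hr, hκ]
    have : 2 * q * lam ≤ 2 * (q * M.k * lam) := by
      nlinarith [mul_le_mul_of_nonneg_right hqk.1 hlam0.le]
    gcongr
  have hqr : q * r ≤ 2 * κ / lmin := by
    have h1 : q * r = 2 * (M.k * lam) / lmin := by rw [hr, ← hqq]; ring
    rw [h1, hκ]
    have := mul_le_mul_of_nonneg_right hqk.2 hlam0.le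
    gcongr
  have hqr3 : (q * r) ^ 3 ≤ 8 * κ * lam / lmin ^ 3 := by
    have h1 : (q * r) ^ 3 = 8 * (κ * κ) * lam / lmin ^ 3 := by
      rw [hr, hκ, ← hqq]; field_simp; ring
    rw [h1]
    have : κ * κ ≤ κ := mul_le_of_le_one_left hκ0 hsmall.le_one
    gcongr
  have hr2 : r ^ 2 ≤ 4 * κ * lam / lmin ^ 2 := by
    have h1 : r ^ 2 = 4 * (M.k * lam) * lam / lmin ^ 2 := by
      rw [hr, ← hqq]; field_simp; ring
    rw [h1, hκ]
    have := mul_le_mul_of_nonneg_right hqk.2 hlam0.le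
    gcongr
  have hc : ∀ i, 0 < M.w (s.dataQ i) / nQ := fun i => div_pos (hw _) hnQ'
  have hapos : 0 < inlierMean s.dataP M.w := by
    refine div_pos (Finset.sum_pos (fun i _ => hw _) ⟨Sum.inl ⟨0, hnP⟩, Finset.mem_univ _⟩) hnP'
  have happrox : ∀ u : Vec d, (∀ t ∉ M.S, u t = 0) → ‖u‖ ≤ r → ∀ t,
      |logLossGrad (fun i => M.w (s.dataQ i) / nQ) (fun i => M.h (s.dataQ i))
        (inlierMean s.dataP M.w) (fun t => inlierMean s.dataP fun x => M.h x t * M.w x)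
        (M.θ₀ + u) t - ∑ s, M.fisher M.θ₀ t s * u s| ≤ α / 4 * lam := by
    intro u huS hur t
    have hσr : ∑ t ∈ M.S, |u t| ≤ q * r :=
      (sum_abs_le_sqrt_card_mul_norm M.S u).trans (mul_le_mul_of_nonneg_left hur hq0)
    have hσ0 : 0 ≤ ∑ t ∈ M.S, |u t| := Finset.sum_nonneg fun _ _ => abs_nonneg _
    have hσκ := hσr.trans hqr
    have hgrad := Setup.abs_logLossGrad_sub_le (x := s.dataQ) hM hB hB1 he hρ hball hw hWmin ha
      haB hz hsm hmm0 hmm hη.le hdev hlow hahat hbhat huS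
      (hur.trans_lt (hrκ.trans_lt hsmall.radius)) rfl (hσκ.trans hsmall.radius_le_one)
      ((mul_le_mul_of_nonneg_left hσκ (by positivity)).trans hsmall.normalizer)
      ((mul_le_mul_of_nonneg_left hσκ (by positivity)).trans hsmall.normalizer') t
    refine hgrad.trans ?_
    set σ := ∑ t ∈ M.S, |u t|
    have hσ3 : σ ^ 3 ≤ 8 * κ * lam / lmin ^ 3 :=
      (pow_le_pow_left₀ hσ0 hσr 3).trans hqr3
    have hu2 : ‖u‖ ^ 2 ≤ 4 * κ * lam / lmin ^ 2 :=
      (pow_le_pow_left₀ (norm_nonneg _) hur 2).trans hr2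
    have hηlam : η * (1 + 4 * B * mm / e + 144 * B ^ 2 / e ^ 2) = α / 8 * lam := by
      rw [hlam, regFactor]; field_simp
    set C₂ := 48 * B ^ 2 / e ^ 2 * (4 / ρ * B * mm) + B * (B ^ 2 / e + B ^ 3 / e ^ 2) / e with hC₂
    have hC₂0 : 0 ≤ C₂ := by positivity
    have h1 : C₂ * σ ^ 3 ≤ C₂ * (8 * κ * lam / lmin ^ 3) := by gcongr
    have h2 : B / e * (l3 * ‖u‖ ^ 2) ≤ B / e * (|l3| * (4 * κ * lam / lmin ^ 2)) := by
      have : l3 * ‖u‖ ^ 2 ≤ |l3| * ‖u‖ ^ 2 := by gcongr; exact le_abs_self _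
      have h3 : |l3| * ‖u‖ ^ 2 ≤ |l3| * (4 * κ * lam / lmin ^ 2) := by gcongr
      exact mul_le_mul_of_nonneg_left (this.trans h3) (by positivity)
    have h3 := mul_le_mul_of_nonneg_right hsmall.remainder hlam0.le
    have h4 : C₂ * (8 * κ * lam / lmin ^ 3) + B / e * (|l3| * (4 * κ * lam / lmin ^ 2)) =
        κ * (8 * C₂ / lmin ^ 3 + 4 * (B / e * |l3|) / lmin ^ 2) * lam := by ring
    have h5 : η + η * (4 * B * mm / e) + 48 * B ^ 2 / e ^ 2 * (3 * η + 4 / ρ * B * mm * σ ^ 3) +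
        B / e * (l3 * ‖u‖ ^ 2) + B * (B ^ 2 / e + B ^ 3 / e ^ 2) / e * σ ^ 3 =
        η * (1 + 4 * B * mm / e + 144 * B ^ 2 / e ^ 2) + C₂ * σ ^ 3 + B / e * (l3 * ‖u‖ ^ 2) := by
      rw [hC₂]; ring
    rw [h5, hηlam]
    linarith
  obtain ⟨θ, hθr, hθS, hθSc, hmin⟩ := exists_unique_lasso_minimizer (S := M.S) (θ₀ := M.θ₀)
    (A := fun t s => M.fisher M.θ₀ t s) (lam := lam) (α := α) (r := r) (lmin := lmin)
    (continuous_logLoss (a := inlierMean s.dataP M.w) (fun i => M.h (s.dataQ i))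
      (fun t => inlierMean s.dataP fun x => M.h x t * M.w x) hc)
    (continuous_logLossGrad _ _ hc) (logLoss_gradient_le _ _ hc hapos) (logLoss_flat _ _ hc hapos)
    (fun t ht => by simpa [Setup.S] using ht) hlmin hlam0 hα hα1 rfl hθ₀ happrox
    (fun v hv => Setup.fisher_quadratic_ge hdep hv)
    (fun v hv β hβ0 hβ t ht => Setup.fisher_incoherent hlmin hdep hinc hv hβ0 hβ ht)
  have hp : 0 < 1 - contamination nP oP := by rw [one_sub_contamination hnP]; positivity
  have huniv : IsUniqueMinimizer (s.objective M ((1 - contamination nP oP) * lam))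
      Set.univ θ := by
    refine ⟨Set.mem_univ _, fun θ' h' hne => ?_⟩
    rw [s.objective_eq M hnP hnQ hw, s.objective_eq M hnP hnQ hw]
    have := mul_lt_mul_of_pos_left (hmin.2 θ' h' hne) hp
    simp only at this
    linarith
  have hθΘ : θ ∈ M.Θ := hball (by
    rw [Metric.mem_ball, dist_eq_norm]
    linarith [hsmall.radius])
  exact ⟨θ, ⟨hθΘ, fun θ' _ hne => huniv.2 θ' (Set.mem_univ _) hne⟩, huniv, hθS, hθSc, hθr⟩

/-! ### Concentration of the inlier means -/

section Concentration

variable {Ω : Type*} [MeasurableSpace Ω] {μ : Measure Ω} [IsProbabilityMeasure μ] {m n : ℕ}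
  {X : Fin n → Ω → Vec m} {P : Measure (Vec m)}

/-- Hoeffding's inequality for one tail of the empirical mean of a bounded function. -/
lemma measure_empMean_sub_gt_le (hX : IsIIDSample μ X P) (hn : 0 < n) {f : Vec m → ℝ}
    (hf : Measurable f) {B : ℝ} (hB : 0 < B) (hfB : ∀ y, |f y| ≤ B) {x : ℝ} (hx : 0 ≤ x) :
    μ.real {ω | B * √(2 * x / n) < empMean (fun i => X i ω) f - ∫ y, f y ∂P} ≤ Real.exp (-x) := by
  have hn' : (0 : ℝ) < n := by exact_mod_cast hn
  have hmean : ∀ i, ∫ ω, f (X i ω) ∂μ = ∫ y, f y ∂P := fun i => by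
    rw [← hX.2.1 i, integral_map (hX.1 i).aemeasurable hf.aestronglyMeasurable]
  have hsub : ∀ i, HasSubgaussianMGF (fun ω => f (X i ω) - ∫ y, f y ∂P)
      ((‖B - -B‖₊ / 2) ^ 2) μ := fun i => by
    rw [← hmean i]
    exact hasSubgaussianMGF_of_mem_Icc (hf.comp (hX.1 i)).aemeasurable
      (Filter.Eventually.of_forall fun ω => abs_le.1 (hfB _))
  have hindep : iIndepFun (fun i ω => f (X i ω) - ∫ y, f y ∂P) μ :=
    hX.2.2.comp (fun _ y => f y - ∫ y, f y ∂P) fun _ => hf.sub_const _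
  have h := HasSubgaussianMGF.measure_sum_ge_le_of_iIndepFun hindep (s := Finset.univ)
    (fun i _ => hsub i) (ε := n * (B * √(2 * x / n))) (by positivity)
  have hexp : -(n * (B * √(2 * x / n))) ^ 2 /
      (2 * ∑ i : Fin n, (((‖B - -B‖₊ / 2) ^ 2 : NNReal) : ℝ)) = -x := by
    have hc : (((‖B - -B‖₊ / 2) ^ 2 : NNReal) : ℝ) = B ^ 2 := by
      push_cast
      rw [Real.norm_of_nonneg (by linarith)]
      ring
    rw [hc, mul_pow, mul_pow, Real.sq_sqrt (by positivity)]
    simp only [Finset.sum_const, Finset.card_univ, Fintype.card_fin, nsmul_eq_mul]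
    field_simp
  push_cast at h hexp
  rw [hexp] at h
  refine le_trans (measureReal_mono fun ω hω => ?_) h
  simp only [Set.mem_ofPred_eq, empMean, Fintype.card_fin] at hω ⊢
  have e : ∑ i, (f (X i ω) - ∫ y, f y ∂P) = n * ((∑ i, f (X i ω)) / n - ∫ y, f y ∂P) := by
    rw [Finset.sum_sub_distrib]
    simp only [Finset.sum_const, Finset.card_univ, Fintype.card_fin, nsmul_eq_mul]
    field_simp
  rw [e]
  gcongr

lemma measure_abs_empMean_sub_gt_le (hX : IsIIDSample μ X P) (hn : 0 < n) {f : Vec m → ℝ}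
    (hf : Measurable f) {B : ℝ} (hB : 0 < B) (hfB : ∀ y, |f y| ≤ B) {x : ℝ} (hx : 0 ≤ x) :
    μ.real {ω | B * √(2 * x / n) < |empMean (fun i => X i ω) f - ∫ y, f y ∂P|} ≤
      2 * Real.exp (-x) := by
  have h1 := measure_empMean_sub_gt_le hX hn hf hB hfB hx
  have h2 := measure_empMean_sub_gt_le hX hn hf.neg hB (fun y => by simpa using hfB y) hx
  have hneg : ∀ ω, empMean (fun i => X i ω) (-f) - ∫ y, (-f) y ∂P =
      -(empMean (fun i => X i ω) f - ∫ y, f y ∂P) := fun ω => by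
    simp only [empMean, Pi.neg_apply, Finset.sum_neg_distrib, integral_neg]
    ring
  simp only [hneg] at h2
  have hsub : {ω | B * √(2 * x / n) < |empMean (fun i => X i ω) f - ∫ y, f y ∂P|} ⊆
      {ω | B * √(2 * x / n) < empMean (fun i => X i ω) f - ∫ y, f y ∂P} ∪
      {ω | B * √(2 * x / n) < -(empMean (fun i => X i ω) f - ∫ y, f y ∂P)} := by
    intro ω hω
    simp only [Set.mem_union, Set.mem_ofPred_eq] at hω ⊢
    exact lt_abs.1 hω
  refine (measureReal_mono hsub).trans ((measureReal_union_le _ _).trans ?_)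
  linarith

/-- Simultaneous concentration for a finite family of bounded functions. -/
lemma measure_compl_forall_empMean_le {ι : Type*} [Fintype ι] (hX : IsIIDSample μ X P)
    (hn : 0 < n) {f : ι → Vec m → ℝ} (hf : ∀ i, Measurable (f i)) {B : ℝ} (hB : 0 < B)
    (hfB : ∀ i y, |f i y| ≤ B) {x : ℝ} (hx : 0 ≤ x) :
    MeasurableSet {ω | ∀ i, |empMean (fun j => X j ω) (f i) - ∫ y, f i y ∂P| ≤
      B * √(2 * x / n)} ∧
    μ.real {ω | ∀ i, |empMean (fun j => X j ω) (f i) - ∫ y, f i y ∂P| ≤ B * √(2 * x / n)}ᶜ ≤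
      Fintype.card ι * (2 * Real.exp (-x)) := by
  constructor
  · rw [Set.ofPred_forall]
    refine MeasurableSet.iInter fun i => measurableSet_le ?_ measurable_const
    refine continuous_abs.measurable.comp (Measurable.sub_const ?_ _)
    exact (Finset.measurable_sum _ fun j _ => (hf i).comp (hX.1 j)).div_const _
  · have e : {ω | ∀ i, |empMean (fun j => X j ω) (f i) - ∫ y, f i y ∂P| ≤ B * √(2 * x / n)}ᶜ =
        ⋃ i, {ω | B * √(2 * x / n) < |empMean (fun j => X j ω) (f i) - ∫ y, f i y ∂P|} := by
      ext ω
      simp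
    rw [e]
    refine (measureReal_iUnion_fintype_le _).trans ((Finset.sum_le_sum fun i _ =>
      measure_abs_empMean_sub_gt_le hX hn (hf i) hB (hfB i) hx).trans ?_)
    simp

/-- The failure probability of the union over all `(d + 1) + (d + 1) (k + 1) ^ 2` moments. -/
lemma union_failure_le {d k : ℕ} (hd : 0 < d) (hk : k ≤ d) {δ : ℝ} (hδ : 0 < δ) (hδ1 : δ < 1) :
    ((d : ℝ) + 1 + (d + 1) * ((k + 1) * (k + 1))) *
      (2 * Real.exp (-(4 * Real.log (6 * d / δ)))) ≤ δ := by
  have hd1 : (1 : ℝ) ≤ d := by exact_mod_cast hd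
  have hk' : (k : ℝ) ≤ d := by exact_mod_cast hk
  have hd0 : (0 : ℝ) < d := by linarith
  have hexp : Real.exp (-(4 * Real.log (6 * d / δ))) = (δ / (6 * d)) ^ 4 := by
    have : -(4 * Real.log (6 * d / δ)) = ((4 : ℕ) : ℝ) * Real.log (6 * d / δ)⁻¹ := by
      rw [Real.log_inv]; push_cast; ring
    rw [this, Real.exp_nat_mul, Real.exp_log (by positivity), inv_div]
  have hcount : (d : ℝ) + 1 + (d + 1) * ((k + 1) * (k + 1)) ≤ 10 * (d : ℝ) ^ 3 := by
    have h1 : (d : ℝ) + 1 ≤ 2 * d := by linarith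
    have h2 : ((d : ℝ) + 1) * ((k + 1) * (k + 1)) ≤ (2 * d) * ((2 * d) * (2 * d)) := by
      gcongr <;> linarith
    have h3 : (d : ℝ) ≤ (d : ℝ) ^ 3 := le_self_pow₀ hd1 (by norm_num)
    nlinarith
  rw [hexp]
  calc _ ≤ 10 * (d : ℝ) ^ 3 * (2 * (δ / (6 * d)) ^ 4) := by gcongr
    _ = 20 / 1296 * (δ ^ 3 / d) * δ := by field_simp; ring
    _ ≤ 1 * δ := by
        gcongr
        have : δ ^ 3 / d ≤ 1 := by
          rw [div_le_one hd0]
          exact (pow_le_one₀ hδ.le hδ1.le).trans hd1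
        nlinarith [show 0 ≤ δ ^ 3 / d by positivity]
    _ = δ := one_mul δ

end Concentration

/-- With probability at least `1 - 2 δ`, all inlier means of the moments at `θ₀` are within
`B √(8 log (6 d / δ) / n)` of their expectations. The lower bound on the normalizing term is a
separate event: without active coordinates, `log d / n` need not be small. -/
theorem exists_concentration_event {Ω : Type*} [MeasurableSpace Ω] {μ : Measure Ω}
    [IsProbabilityMeasure μ] {m d nP nQ : ℕ} {M : Setup m d} {B e δ : ℝ}
    {XP : Fin nP → Ω → Vec m} {XQ : Fin nQ → Ω → Vec m}
    (hXP : IsIIDSample μ XP M.P) (hXQ : IsIIDSample μ XQ M.Q)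
    (hM : M.IsValid) (hB : M.TiltBound B) (hB0 : 0 < B) (hwB : ∀ x, |M.w x| ≤ B)
    (hhB : ∀ x t, |M.h x t * M.w x| ≤ B) (hθ₀ : M.θ₀ ∈ M.Θ) (he : 0 < e)
    (hz : e ≤ M.mom M.θ₀ none none none) (hd : 0 < d) (hnP : 0 < nP) (hnQ : 0 < nQ)
    (hδ : 0 < δ) (hδ1 : δ < 1)
    (hn : 8 * B ^ 2 * Real.log (2 / δ) / e ^ 2 ≤ (min nP nQ : ℕ)) :
    ∃ A : Set Ω, MeasurableSet A ∧ ENNReal.ofReal (1 - 2 * δ) ≤ μ A ∧ ∀ ω ∈ A,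
      |empMean (fun i => XP i ω) M.w - ∫ x, M.w x ∂M.P| ≤
        B * √8 * √(Real.log (6 * d / δ) / (min nP nQ : ℕ)) ∧
      (∀ t, |empMean (fun i => XP i ω) (fun x => M.h x t * M.w x) -
        ∫ x, M.h x t * M.w x ∂M.P| ≤ B * √8 * √(Real.log (6 * d / δ) / (min nP nQ : ℕ))) ∧
      (∀ a, ∀ b ∈ M.S.insertNone, ∀ c ∈ M.S.insertNone,
        |empMean (fun i => XQ i ω) (M.tilt M.θ₀ a b c) - M.mom M.θ₀ a b c| ≤
          B * √8 * √(Real.log (6 * d / δ) / (min nP nQ : ℕ))) ∧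
      e / 2 ≤ empMean (fun i => XQ i ω) (M.tilt M.θ₀ none none none) := by
  have hd1 : (1 : ℝ) ≤ d := by exact_mod_cast hd
  have hx0 : 0 ≤ Real.log (6 * d / δ) := by
    refine Real.log_nonneg ?_
    rw [le_div_iff₀ hδ]
    linarith
  have hy0 : 0 ≤ Real.log (2 / δ) := by
    refine Real.log_nonneg ?_
    rw [le_div_iff₀ hδ]
    linarith
  have hmin : (0 : ℝ) < (min nP nQ : ℕ) := by exact_mod_cast lt_min hnP hnQ
  have hrad : ∀ n : ℕ, min nP nQ ≤ n → B * √(2 * (4 * Real.log (6 * d / δ)) / n) ≤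
      B * √8 * √(Real.log (6 * d / δ) / (min nP nQ : ℕ)) := by
    intro n hn
    have hn' : ((min nP nQ : ℕ) : ℝ) ≤ n := by exact_mod_cast hn
    rw [mul_assoc, ← Real.sqrt_mul (by norm_num)]
    refine mul_le_mul_of_nonneg_left (Real.sqrt_le_sqrt ?_) hB0.le
    calc _ = 8 * (Real.log (6 * d / δ) / n) := by ring
      _ ≤ _ := by gcongr
  set fP : Option (Fin d) → Vec m → ℝ := fun a x => a.elim (M.w x) fun t => M.h x t * M.w x
  have hh : ∀ t, Measurable fun x => M.h x t := fun t =>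
    (by fun_prop : Measurable fun v : Vec d => v t).comp hM.measurable_h
  obtain ⟨m1, p1⟩ := measure_compl_forall_empMean_le (f := fP) hXP hnP
    (by rintro (_ | t); exacts [hM.measurable_w, (hh t).mul hM.measurable_w]) hB0
    (by rintro (_ | t) y; exacts [hwB y, hhB y t])
    (by positivity : 0 ≤ 4 * Real.log (6 * d / δ))
  set fQ : Option (Fin d) × M.S.insertNone × M.S.insertNone → Vec m → ℝ :=
    fun i => M.tilt M.θ₀ i.1 i.2.1 i.2.2
  obtain ⟨m2, p2⟩ := measure_compl_forall_empMean_le (f := fQ) hXQ hnQ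
    (fun i => Setup.measurable_tilt hM _ _ _ _) hB0
    (fun i y => hB _ hθ₀ _ _ i.2.1.2 _ i.2.2.2 y)
    (by positivity : 0 ≤ 4 * Real.log (6 * d / δ))
  obtain ⟨m3, p3⟩ := measure_compl_forall_empMean_le (ι := Unit)
    (f := fun _ => M.tilt M.θ₀ none none none) hXQ hnQ
    (fun i => Setup.measurable_tilt hM _ _ _ _) hB0
    (fun i y => hB _ hθ₀ _ _ (by simp) _ (by simp) y) hy0
  set E1 := {ω | ∀ i, |empMean (fun j => XP j ω) (fP i) - ∫ y, fP i y ∂M.P| ≤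
    B * √(2 * (4 * Real.log (6 * d / δ)) / nP)}
  set E2 := {ω | ∀ i, |empMean (fun j => XQ j ω) (fQ i) - ∫ y, fQ i y ∂M.Q| ≤
    B * √(2 * (4 * Real.log (6 * d / δ)) / nQ)}
  set E3 := {ω | ∀ _ : Unit, |empMean (fun j => XQ j ω) (M.tilt M.θ₀ none none none) -
    ∫ y, M.tilt M.θ₀ none none none y ∂M.Q| ≤ B * √(2 * Real.log (2 / δ) / nQ)}
  have hfail : μ.real (E1 ∩ E2 ∩ E3)ᶜ ≤ 2 * δ := by
    rw [Set.compl_inter, Set.compl_inter]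
    have q1 := measureReal_union_le (μ := μ) (E1ᶜ ∪ E2ᶜ) E3ᶜ
    have q2 := measureReal_union_le (μ := μ) E1ᶜ E2ᶜ
    have hS : M.S.card ≤ d := (Finset.card_le_univ _).trans_eq (by simp)
    have q3 := union_failure_le hd hS hδ hδ1
    have q4 : Real.exp (-Real.log (2 / δ)) = δ / 2 := by
      rw [← Real.log_inv, Real.exp_log (by positivity), inv_div]
    rw [q4] at p3
    simp only [Fintype.card_option, Fintype.card_fin, Fintype.card_prod, Fintype.card_coe,
      Finset.card_insertNone, Fintype.card_unit] at p1 p2 p3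
    push_cast at p1 p2 p3
    rw [add_mul] at q3
    linarith
  refine ⟨E1 ∩ E2 ∩ E3, (m1.inter m2).inter m3, ?_, ?_⟩
  · rw [ENNReal.ofReal_le_iff_le_toReal (measure_ne_top _ _)]
    have := probReal_compl_eq_one_sub (μ := μ) ((m1.inter m2).inter m3)
    change _ ≤ μ.real _
    linarith
  · rintro ω ⟨⟨h1, h2⟩, h3⟩
    refine ⟨(h1 none).trans (hrad nP (min_le_left _ _)),
      fun t => (h1 (some t)).trans (hrad nP (min_le_left _ _)),
      fun a b hb c hc => (h2 (a, ⟨b, hb⟩, ⟨c, hc⟩)).trans (hrad nQ (min_le_right _ _)), ?_⟩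
    have h4 : B * √(2 * Real.log (2 / δ) / nQ) ≤ e / 2 := by
      have hle : ((min nP nQ : ℕ) : ℝ) ≤ nQ := by exact_mod_cast min_le_right _ _
      have hnQ' : (0 : ℝ) < nQ := by exact_mod_cast hnQ
      rw [← Real.sqrt_sq hB0.le, ← Real.sqrt_mul (sq_nonneg B)]
      refine (Real.sqrt_le_sqrt ?_).trans_eq (Real.sqrt_sq (by positivity : 0 ≤ e / 2))
      have h5 := hn.trans hle
      rw [div_le_iff₀ (by positivity)] at h5
      rw [← mul_div_assoc, div_le_iff₀ hnQ']
      linarith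
    have h5 := (abs_le.1 ((h3 ()).trans h4)).1
    change -(e / 2) ≤ _ - M.mom M.θ₀ none none none at h5
    linarith

/-! ### Choice of the constants -/

lemma rpow_three_halves {x : ℝ} (hx : 0 ≤ x) : x ^ (3 / 2 : ℝ) = √x * x := by
  rcases hx.eq_or_lt with rfl | h
  · rw [Real.zero_rpow (by norm_num), mul_zero]
  · rw [show (3 / 2 : ℝ) = 1 / 2 + 1 by norm_num, Real.rpow_add_one h.ne', Real.sqrt_eq_rpow]

/-- `k³ log (6 d / δ)` is controlled by `max 1 (k³ log d)`; for `d = 1` this uses `k ≤ 1`. -/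
lemma cube_mul_log_le {d k : ℕ} (hd : 0 < d) (hk : k ≤ d) {δ : ℝ} (hδ : 0 < δ) (hδ1 : δ < 1) :
    (k : ℝ) ^ 3 * Real.log (6 * d / δ) ≤
      (1 + 2 * Real.log (6 / δ)) * max 1 ((k : ℝ) ^ 3 * Real.log d) := by
  have hd0 : (0 : ℝ) < d := by exact_mod_cast hd
  have hlog : Real.log (6 * d / δ) = Real.log d + Real.log (6 / δ) := by
    rw [← Real.log_mul hd0.ne' (by positivity)]
    congr 1; ring
  have hl0 : 0 ≤ Real.log (6 / δ) := by
    refine Real.log_nonneg ?_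
    rw [le_div_iff₀ hδ]
    linarith
  have hk3 : (k : ℝ) ^ 3 ≤ 2 * max 1 ((k : ℝ) ^ 3 * Real.log d) := by
    rcases Nat.lt_or_ge 1 d with h | h
    · have h1 : Real.log 2 ≤ Real.log d :=
        Real.log_le_log (by norm_num) (by exact_mod_cast h)
      have h2 := Real.log_two_gt_d9
      have h3 : (k : ℝ) ^ 3 * (1 / 2) ≤ (k : ℝ) ^ 3 * Real.log d := by
        gcongr
        linarith
      linarith [le_max_right 1 ((k : ℝ) ^ 3 * Real.log d)]
    · have h1 : (k : ℝ) ≤ 1 := by exact_mod_cast hk.trans h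
      have h2 : (k : ℝ) ^ 3 ≤ 1 := pow_le_one₀ k.cast_nonneg h1
      linarith [le_max_left 1 ((k : ℝ) ^ 3 * Real.log d)]
  rw [hlog, mul_add]
  have h1 := mul_le_mul_of_nonneg_right hk3 hl0
  linarith [le_max_right 1 ((k : ℝ) ^ 3 * Real.log d)]

lemma outlier_ratio_eq {n o : ℕ} (hn : 0 < n) :
    (o : ℝ) / n = contamination n o / (1 - contamination n o) := by
  have : (0 : ℝ) < n := by exact_mod_cast hn
  have : (0 : ℝ) < (n : ℝ) + o := by positivity
  rw [one_sub_contamination hn, contamination]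
  field_simp

lemma total_ratio_le {n o : ℕ} {εbar : ℝ} (hn : 0 < n) (hε : εbar < 1)
    (h : contamination n o ≤ εbar) : ((n : ℝ) + o) / n ≤ 1 / (1 - εbar) := by
  have : ((n : ℝ) + o) / n = 1 / (1 - contamination n o) := by
    rw [one_sub_contamination hn, one_div_div]
  rw [this]
  exact one_div_le_one_div_of_le (by linarith) (by linarith)

lemma contamination_nonneg (n o : ℕ) : 0 ≤ contamination n o := by
  unfold contamination
  positivity

end WeightedDRE

open WeightedDRE in
theorem corollary1
    (Wmin Wmax Emin Emax Dmax α εbar : ℝ)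
    (hWmin : 0 < Wmin) (hEmin : 0 < Emin) (hα : 0 < α) (hα1 : α ≤ 1) (hεbar : εbar < 1) :
    ∃ L N : ℝ, 0 < L ∧ 0 < N ∧
    ∀ lmin l3 ρ : ℝ, 0 < lmin → 0 < ρ →
    ∃ c : ℝ, 0 < c ∧
    ∀ δ : ℝ, 0 < δ → δ < 1 →
    ∃ K : ℝ, 0 < K ∧
    ∀ (m d nP oP nQ oQ : ℕ) (M : WeightedDRE.Setup m d),
      M.IsValid → Metric.ball M.θ₀ ρ ⊆ M.Θ →
      M.BoundedWeight Wmin Wmax → M.BoundedRatio Emin Emax → M.BoundedFeatures Dmax →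
      M.Dependency lmin → M.Incoherence α → M.Smoothness l3 →
      WeightedDRE.contamination nP oP ≤ εbar → WeightedDRE.contamination nQ oQ ≤ εbar →
      K * max 1 ((M.k : ℝ) ^ 3 * Real.log (d : ℝ)) ≤ (min nP nQ : ℕ) →
    ∀ (Ω : Type*) [MeasurableSpace Ω] (μ : MeasureTheory.Measure Ω)
      [MeasureTheory.IsProbabilityMeasure μ]
      (XP : Fin nP → Ω → WeightedDRE.Vec m) (ZP : Fin oP → Ω → WeightedDRE.Vec m)
      (XQ : Fin nQ → Ω → WeightedDRE.Vec m) (ZQ : Fin oQ → Ω → WeightedDRE.Vec m),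
      WeightedDRE.IsIIDSample μ XP M.P → WeightedDRE.IsIIDSample μ XQ M.Q →
    ∃ A : Set Ω, MeasurableSet A ∧ ENNReal.ofReal (1 - 8 * δ) ≤ μ A ∧
    ∀ ω ∈ A,
      let s : WeightedDRE.Sample m nP oP nQ oQ :=
        ⟨fun i => XP i ω, fun i => ZP i ω, fun i => XQ i ω, fun i => ZQ i ω⟩
      let εp : ℝ := WeightedDRE.contamination nP oP
      let ε : ℝ := max εp (WeightedDRE.contamination nQ oQ)
      let ν : ℝ := s.nu M
      let k : ℝ := (M.k : ℝ)
      let n : ℝ := ((min nP nQ : ℕ) : ℝ)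
      let lam : ℝ := L * (1 - εp) * √(Real.log (6 * d / δ) / n) + N * ε * ν
      k ^ (3 / 2 : ℝ) * ε * ν ≤ c →
      (∀ t ∈ M.S, 80 * L / lmin * √(k * Real.log (6 * d / δ) / n)
          + 80 * N / lmin * (ε * ν * √k / (1 - εp)) ≤ |M.θ₀ t|) →
      ∃ θhat : WeightedDRE.Vec d,
        WeightedDRE.IsUniqueMinimizer (s.objective M lam) M.Θ θhat ∧
        WeightedDRE.IsUniqueMinimizer (s.objective M lam) Set.univ θhat ∧
        (∀ t ∈ M.S, θhat t ≠ 0) ∧ (∀ t ∉ M.S, θhat t = 0) ∧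
        ‖θhat - M.θ₀‖ ≤ 40 * L / lmin * √(k * Real.log (6 * d / δ) / n)
          + 40 * N / lmin * (ε * ν * √k / (1 - εp)) := by
  set B : ℝ := max 1 (max Wmax (max Emax Dmax)) with hBdef
  have hB1 : 1 ≤ B := le_max_left _ _
  have hWB : Wmax ≤ B := (le_max_left _ _).trans (le_max_right _ _)
  have hEB : Emax ≤ B := (le_max_left _ _).trans ((le_max_right _ _).trans (le_max_right _ _))
  have hDB : Dmax ≤ B := (le_max_right _ _).trans ((le_max_right _ _).trans (le_max_right _ _))
  have hB0 : 0 < B := by linarith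
  set mm : ℝ := 1 / (1 - εbar) with hmm
  have hmm0 : 0 < mm := one_div_pos.2 (by linarith)
  set G : ℝ := regFactor B Emin mm α with hG
  have hG0 : 0 < G := by rw [hG, regFactor]; positivity
  have hL0 : 0 < G * (B * √8) := by positivity
  have hN0 : 0 < G * mm := by positivity
  refine ⟨G * (B * √8), G * mm, hL0, hN0, fun lmin l3 ρ hlmin hρ => ?_⟩
  set L := G * (B * √8) with hL
  set N := G * mm with hN
  obtain ⟨c₀, hc₀, hsmall⟩ := exists_isSmall B mm l3 (lmin := lmin) hEmin hα hρ
  refine ⟨c₀ / (2 * N * mm), by positivity, fun δ hδ hδ1 => ?_⟩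
  set ℓ := 1 + 2 * Real.log (6 / δ) with hℓ
  have hℓ0 : 0 < ℓ := by
    have : 0 ≤ Real.log (6 / δ) := by
      refine Real.log_nonneg ?_
      rw [le_div_iff₀ hδ]
      linarith
    linarith
  refine ⟨max 1 (max (ℓ * (2 * L / c₀) ^ 2) (8 * B ^ 2 * Real.log (2 / δ) / Emin ^ 2)),
    lt_max_of_lt_left one_pos, ?_⟩
  intro m d nP oP nQ oQ M hM hball hbw hbr hbf hdep hinc hsm hcP hcQ hK Ω _ μ _ XP ZP XQ ZQ hXP hXQ
  have hw : ∀ x, 0 < M.w x := fun x => (hbw.1 x).1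
  have hθ₀Θ : M.θ₀ ∈ M.Θ := hball (Metric.mem_ball_self hρ)
  have hεp1 : 0 < 1 - contamination nP oP := by linarith
  have hεq1 : 0 < 1 - contamination nQ oQ := by linarith
  rcases Nat.eq_zero_or_pos d with rfl | hd
  · refine ⟨Set.univ, MeasurableSet.univ, ?_, fun ω _ => ?_⟩
    · rw [measure_univ]
      exact ENNReal.ofReal_le_one.2 (by linarith)
    · intro s εp ε ν k n lam _ _
      have hk : M.k = 0 := by simp [Setup.k, Finset.eq_empty_of_isEmpty]
      exact ⟨M.θ₀, ⟨hθ₀Θ, fun b _ hb => absurd (Subsingleton.elim _ _) hb⟩,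
        ⟨Set.mem_univ _, fun b _ hb => absurd (Subsingleton.elim _ _) hb⟩,
        fun t => t.elim0, fun t => t.elim0, by simp [k, hk]⟩
  have hB := Setup.tiltBound_of_bounded hbw hbr hbf hEB hDB
  have := hM.prob_P
  have haB : ∫ x, M.w x ∂M.P ≤ B := by
    have h := norm_integral_le_of_norm_le_const (μ := M.P) (f := M.w) (C := B)
      (Filter.Eventually.of_forall fun x => by
        rw [Real.norm_of_nonneg (hw x).le]; exact (hbw.1 x).2.trans hWB)
    simpa using (le_abs_self _).trans h
  have hz : Emin ≤ M.mom M.θ₀ none none none := by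
    rw [← Setup.integral_expF_mul_w]
    exact (hbr M.θ₀ hθ₀Θ).2
  set K := max 1 (max (ℓ * (2 * L / c₀) ^ 2) (8 * B ^ 2 * Real.log (2 / δ) / Emin ^ 2)) with hKdef
  have hK0 : 0 < K := lt_max_of_lt_left one_pos
  have hKn : K ≤ (min nP nQ : ℕ) := (le_mul_of_one_le_right hK0.le (le_max_left _ _)).trans hK
  have hn1 : (0 : ℝ) < (min nP nQ : ℕ) := hK0.trans_le hKn
  have hnmin : 0 < min nP nQ := by exact_mod_cast hn1
  have hnP : 0 < nP := (lt_min_iff.1 hnmin).1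
  have hnQ : 0 < nQ := (lt_min_iff.1 hnmin).2
  obtain ⟨A, hA, hμA, hAω⟩ := exists_concentration_event hXP hXQ hM hB hB0
    (fun x => by rw [abs_of_pos (hw x)]; exact (hbw.1 x).2.trans hWB)
    (fun x t => (hbf.1 x t).trans hDB) hθ₀Θ hEmin hz hd hnP hnQ hδ hδ1
    (((le_max_right _ _).trans (le_max_right _ _)).trans hKn)
  refine ⟨A, hA, (ENNReal.ofReal_le_ofReal (by linarith)).trans hμA, fun ω hω => ?_⟩
  obtain ⟨g1, g2, g3, g4⟩ := hAω ω hω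
  intro s εp ε ν k n lam hc hθ₀
  have hn : 0 < n := hn1
  have hν : 0 ≤ ν := s.nu_nonneg hw
  have hεp0 : 0 ≤ εp := contamination_nonneg _ _
  have hε0 : 0 ≤ ε := hεp0.trans (le_max_left _ _)
  have hεp1' : 0 < 1 - εp := hεp1
  have hk0 : 0 ≤ k := Nat.cast_nonneg _
  have hmmP : 1 / (1 - εp) ≤ mm := one_div_le_one_div_of_le (by linarith) (by linarith [hcP])
  have hmmQ : 1 / (1 - contamination nQ oQ) ≤ mm :=
    one_div_le_one_div_of_le (by linarith) (by linarith)
  have hmm1 : 1 ≤ mm := by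
    refine le_trans ?_ hmmP
    rw [le_div_iff₀ hεp1']
    linarith
  set x := Real.log (6 * d / δ) with hx
  have hd1 : (1 : ℝ) ≤ d := by exact_mod_cast hd
  have hx0 : 0 < x := by
    refine Real.log_pos ?_
    rw [lt_div_iff₀ hδ]
    linarith
  set T := √(x / n) with hT
  have hT0 : 0 < T := Real.sqrt_pos.2 (by positivity)
  -- `η` bounds all deviations of the moments, `lam' = lam / (1 - εp)` is the multiple `G η`.
  set η := B * √8 * T + mm * (ε * ν / (1 - εp)) with hη
  have hεν : 0 ≤ ε * ν / (1 - εp) := by positivity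
  have hη0 : 0 < η := by positivity
  set lam' := G * η with hlam'
  have hlam'0 : 0 < lam' := by positivity
  have hlam'_eq : lam' = L * T + N * (ε * ν / (1 - εp)) := by
    rw [hlam', hη, hL, hN]; ring
  have hlam_eq : lam = (1 - contamination nP oP) * lam' := by
    rw [hlam'_eq]
    change L * (1 - εp) * T + N * ε * ν = (1 - εp) * _
    field_simp
  have hoP : (oP : ℝ) / nP * ν ≤ mm * (ε * ν / (1 - εp)) := by
    rw [outlier_ratio_eq hnP]
    calc εp / (1 - εp) * ν = 1 * (εp * ν / (1 - εp)) := by ring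
      _ ≤ mm * (ε * ν / (1 - εp)) := by gcongr; exact le_max_left _ _
  have hoQ : (oQ : ℝ) / nQ * ν ≤ mm * (ε * ν / (1 - εp)) := by
    rw [outlier_ratio_eq hnQ]
    calc contamination nQ oQ / (1 - contamination nQ oQ) * ν
        = 1 / (1 - contamination nQ oQ) * (contamination nQ oQ * ν) := by ring
      _ ≤ mm * (ε * ν) := by
          gcongr
          · exact mul_nonneg (contamination_nonneg _ _) hν
          · exact le_max_right _ _
      _ ≤ mm * (ε * ν / (1 - εp)) := by
          gcongr
          rw [le_div_iff₀ hεp1']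
          exact mul_le_of_le_one_right (by positivity) (by linarith)
  have hsqrtk : √(k * x / n) = √k * T := by
    rw [hT, ← Real.sqrt_mul hk0, mul_div_assoc]
  -- The regularization is small on the scale `k ^ (3 / 2)`.
  have hκ : √k * k * lam' ≤ c₀ := by
    have h1 : √k * k * (L * T) ≤ c₀ / 2 := by
      have hle : (k ^ 3 * x) / n ≤ (c₀ / (2 * L)) ^ 2 := by
        have hkd : M.k ≤ d := (Finset.card_le_univ _).trans_eq (by simp)
        have h3 : k ^ 3 * x ≤ ℓ * max 1 ((M.k : ℝ) ^ 3 * Real.log d) :=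
          cube_mul_log_le hd hkd hδ hδ1
        have h4 : ℓ * (2 * L / c₀) ^ 2 * max 1 ((M.k : ℝ) ^ 3 * Real.log d) ≤ n := by
          refine le_trans ?_ hK
          gcongr
          exact (le_max_left _ _).trans (le_max_right _ _)
        rw [div_le_iff₀ hn]
        have h5 : (c₀ / (2 * L)) ^ 2 *
            (ℓ * (2 * L / c₀) ^ 2 * max 1 ((M.k : ℝ) ^ 3 * Real.log d)) =
            ℓ * max 1 ((M.k : ℝ) ^ 3 * Real.log d) := by field_simp
        calc k ^ 3 * x ≤ _ := h3
          _ = _ := h5.symm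
          _ ≤ _ := by gcongr
      have h6 : √k * k * T ≤ c₀ / (2 * L) := by
        have h7 : (√k * k * T) ^ 2 = (k ^ 3 * x) / n := by
          rw [mul_pow, mul_pow, Real.sq_sqrt hk0, hT, Real.sq_sqrt (by positivity)]
          ring
        exact (abs_le_of_sq_le_sq' (h7.trans_le hle) (by positivity)).2
      calc √k * k * (L * T) = L * (√k * k * T) := by ring
        _ ≤ L * (c₀ / (2 * L)) := by gcongr
        _ = c₀ / 2 := by field_simp
    have h2 : √k * k * (N * (ε * ν / (1 - εp))) ≤ c₀ / 2 := by
      rw [rpow_three_halves hk0] at hc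
      calc √k * k * (N * (ε * ν / (1 - εp))) = N * (√k * k * ε * ν) * (1 / (1 - εp)) := by ring
        _ ≤ N * (c₀ / (2 * N * mm)) * mm := by gcongr
        _ = c₀ / 2 := by field_simp
    rw [hlam'_eq, mul_add]
    linarith
  have hrad : 2 * √k * lam' / lmin =
      2 * (L / lmin * (√k * T)) + 2 * (N / lmin * (ε * ν * √k / (1 - εp))) := by
    rw [hlam'_eq]; ring
  have hr1 : 0 ≤ L / lmin * (√k * T) := by positivity
  have hr2 : 0 ≤ N / lmin * (ε * ν * √k / (1 - εp)) := by positivity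
  obtain ⟨θ, h1, h2, h3, h4, h5⟩ := s.exists_sparse_minimizer (η := η) (mm := mm) (l3 := l3)
    (lam := lam') hM hB hB1 hEmin hρ hball hw hWmin hbw.2 haB hz hlmin hα hα1 hdep hinc hsm hnP hnQ
    hmm0.le (total_ratio_le hnQ hεbar hcQ) hη0
    (fun a b hb c hc => (abs_inlierMean_sub_le _ _ (g3 a b hb c hc)
      fun j => s.abs_tilt_outQ_le_nu hB hw hθ₀Θ hbf a hb hc j).trans (add_le_add_right hoQ _))
    (g4.trans (empMean_le_inlierMean _ _ fun y => by
      simpa [Setup.tilt] using (mul_pos (Setup.expF_pos _ _) (hw y)).le))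
    ((abs_inlierMean_sub_le _ _ g1 fun j => by
      rw [abs_of_pos (hw _)]; exact s.w_outP_le_nu M j).trans (add_le_add_right hoP _))
    (fun t => (abs_inlierMean_sub_le _ _ (g2 t)
      fun j => s.abs_h_mul_w_outP_le_nu hw t j).trans (add_le_add_right hoP _))
    rfl (hsmall _ (by positivity) hκ)
    (fun t ht => by
      have hkpos : 0 < k := by
        have : 0 < M.k := Finset.card_pos.2 ⟨t, ht⟩
        exact Nat.cast_pos.2 this
      have hpos : 0 < 2 * √k * lam' / lmin := by
        have := Real.sqrt_pos.2 hkpos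
        positivity
      refine lt_of_lt_of_le ?_ (hθ₀ t ht)
      rw [hsqrtk]
      rw [hrad] at hpos
      change 2 * √k * lam' / lmin < _
      rw [hrad]
      have e1 : 80 * L / lmin * (√k * T) = 80 * (L / lmin * (√k * T)) := by ring
      have e2 : 80 * N / lmin * (ε * ν * √k / (1 - εp)) =
        80 * (N / lmin * (ε * ν * √k / (1 - εp))) := by ring
      rw [e1, e2]
      linarith)
  rw [← hlam_eq] at h1 h2
  refine ⟨θ, h1, h2, h3, h4, h5.trans ?_⟩
  change 2 * √k * lam' / lmin ≤ _
  rw [hsqrtk, hrad]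
  have e1 : 40 * L / lmin * (√k * T) = 40 * (L / lmin * (√k * T)) := by ring
  have e2 : 40 * N / lmin * (ε * ν * √k / (1 - εp)) =
    40 * (N / lmin * (ε * ν * √k / (1 - εp))) := by ring
  rw [e1, e2]
  linarith
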